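/- Let $a>0$ and $b\ge 0$, and let $u$ be a $C^2$ solution of $$\frac{u''}{(1+u'^2)^{3/2}}+\frac1r\,\frac{u'}{\sqrt{1+u'^2}}=ar^2+b,\qquad u'(0)=0,$$ with maximal interval of definition $[0,c_0)$. Let $M\subset\mathbb R^3$ be an axisymmetric closed stationary rotating surface of type I generated by $u$. That is, $M$ is a smooth closed (compact, connected, without boundary) embedded surface, oriented by a Gauss map $N=(N_1,N_2,N_3)$, whose mean curvature $H$ (half the trace of $-dN$) satisfies $2H=ar^2+b$ with $r=\sqrt{x_1^2+x_2^2}$, and $M$ is obtained by rotating the graph $x_3=u(r)$, $0\le r<c_0$, about the $x_3$-axis, reflecting the result about the plane $x_3=u(c_0)$, where $u(c_0)=\lim_{r\to c_0^-}u(r)$, and adding the circle $r=c_0$, $x_3=u(c_0)$. For smooth functions $f$ on $M$ put $$Q(f)=-\int_M f\Big(\Delta f+\big(|\sigma|^2-2a(\langle N,x\rangle-x_3N_3)\big)f\Big)\,dM ,$$ where $\Delta$ is the Laplace–Beltrami operator and $\sigma$ the second fundamental form of $M$; $M$ is called stable if $Q(f)\ge 0$ for all $f\in C^\infty(M)$ with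 $\int_M f\,dM=0$. Then $M$ is not stable. More precisely, the function $N_1$ satisfies $\int_M N_1\,dM=0$, the function $r^2u'(r)$ is integrable on $(0,c_0)$, and $$Q(N_1)=-4\pi a\int_0^{c_0}r^2u'(r)\,dr<0 .$$ -/

import Mathlib

open Set Filter Topology MeasureTheory
open scoped ContDiff

noncomputable section

/-- Euclidean three-space. The coordinates `x₁, x₂, x₃` of `x` are `x 0, x 1, x 2`. -/
abbrev E3 : Type := EuclideanSpace ℝ (Fin 3)

/-- The distance `r(x) = √(x₁² + x₂²)` from `x` to the `x₃`-axis. -/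
def axisDist (x : E3) : ℝ := √((x 0) ^ 2 + (x 1) ^ 2)

/-! ### Closed oriented surfaces and tangential calculus

A closed oriented surface is a compact connected set `M ⊆ ℝ³` which is locally a regular level set
of a smooth function, together with (a smooth extension to `ℝ³` of) its Gauss map `N`.
Smooth functions on the compact embedded surface `M` are represented by smooth functions on `ℝ³`.
At points of `M`, all operators below depend on the restrictions to `M` of their arguments only. -/

/-- `M` is a closed (compact, connected, without boundary) smooth surface embedded in `ℝ³`,
oriented by the Gauss map `N`. -/
structure IsClosedOrientedSurface (M : Set E3) (N : E3 → E3) : Prop where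
  isCompact : IsCompact M
  isConnected : IsConnected M
  smooth_normal : ContDiff ℝ ∞ N
  norm_normal : ∀ x ∈ M, ‖N x‖ = 1
  /-- Near each of its points, `M` is a regular level set `φ = 0`, and `N` is orthogonal to its
  tangent planes `ker dφ`. -/
  regular : ∀ p ∈ M, ∃ (U : Set E3) (φ : E3 → ℝ), IsOpen U ∧ p ∈ U ∧ ContDiffOn ℝ ∞ φ U ∧
    M ∩ U = {x | x ∈ U ∧ φ x = 0} ∧
    ∀ x ∈ M ∩ U, fderiv ℝ φ x ≠ 0 ∧ ∀ w : E3, fderiv ℝ φ x w = 0 → inner ℝ (N x) w = 0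

/-- The component of `w` orthogonal to the (unit) vector `n`. -/
def tangentPart (n w : E3) : E3 := w - inner ℝ w n • n

/-- The tangential divergence `∑ᵢ ⟨D_{Eᵢᵀ} V, Eᵢ⟩` at `x` of a vector field `V` along the surface
with Gauss map `N`, where `Eᵢᵀ` is the tangential part of the `i`-th canonical vector. -/
def surfaceDiv (N : E3 → E3) (V : E3 → E3) (x : E3) : ℝ :=
  ∑ i : Fin 3, inner ℝ (fderiv ℝ V x (tangentPart (N x) (EuclideanSpace.single i 1)))
    (EuclideanSpace.single i 1)

/-- The gradient of `f` on the surface: the tangential part of the gradient of `f` in `ℝ³`. -/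
def surfaceGradient (N : E3 → E3) (f : E3 → ℝ) (x : E3) : E3 :=
  tangentPart (N x) (gradient f x)

/-- The Laplace-Beltrami operator of the surface with Gauss map `N`. -/
def surfaceLaplacian (N : E3 → E3) (f : E3 → ℝ) (x : E3) : ℝ :=
  surfaceDiv N (surfaceGradient N f) x

/-- The mean curvature `H`, half the trace of `-dN` on the tangent plane (so that a round sphere
has `H > 0` for the normal that points inside). -/
def meanCurvature (N : E3 → E3) (x : E3) : ℝ := -(1 / 2) * surfaceDiv N N x

/-- The squared norm `|σ|²` of the second fundamental form, i.e. of `dN` on the tangent plane. -/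
def sqNormSecondForm (N : E3 → E3) (x : E3) : ℝ :=
  ∑ i : Fin 3, ‖fderiv ℝ N x (tangentPart (N x) (EuclideanSpace.single i 1))‖ ^ 2

/-- The integral over `M` with respect to its area element `dM`, the two-dimensional Hausdorff
measure normalized as Euclidean area. -/
def surfaceIntegral (M : Set E3) (f : E3 → ℝ) : ℝ := ∫ x in M, f x ∂μHE[2]

/-! ### Stationary rotating surfaces and stability -/

/-- `M`, oriented by `N`, is a closed embedded stationary rotating surface with respect to the
`x₃`-axis: its mean curvature satisfies `2 H = a r² + b`. -/
structure IsStationaryRotatingSurface (a b : ℝ) (M : Set E3) (N : E3 → E3) : Prop where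
  surface : IsClosedOrientedSurface M N
  laplace_eq : ∀ x ∈ M, 2 * meanCurvature N x = a * axisDist x ^ 2 + b

/-- The operator `L[f] = Δ f + (|σ|² - 2 a (h - x₃ N₃)) f`, where `h = ⟨N, x⟩`. -/
def jacobiOperator (a : ℝ) (N : E3 → E3) (f : E3 → ℝ) (x : E3) : ℝ :=
  surfaceLaplacian N f x +
    (sqNormSecondForm N x - 2 * a * (inner ℝ (N x) x - x 2 * N x 2)) * f x

/-- The second variation `-∫_M f L[f] dM` of the energy. -/
def secondVariation (a : ℝ) (M : Set E3) (N : E3 → E3) (f : E3 → ℝ) : ℝ :=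
  -surfaceIntegral M (fun x => f x * jacobiOperator a N f x)

/-- Stability of a closed surface: the second variation is nonnegative at every smooth
function with zero mean. -/
def IsStable (a : ℝ) (M : Set E3) (N : E3 → E3) : Prop :=
  ∀ f : E3 → ℝ, ContDiff ℝ ∞ f → surfaceIntegral M f = 0 → 0 ≤ secondVariation a M N f

/-! ### Axisymmetric closed surfaces -/

/-- `u` is a solution on `[0, c)` of
`u'' / (1 + u'²)^{3/2} + (1/r) u' / √(1 + u'²) = a r² + b`, `u'(0) = 0`. -/
structure IsProfile (a b c : ℝ) (u : ℝ → ℝ) : Prop where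
  pos : 0 < c
  contDiffOn : ContDiffOn ℝ 2 u (Ico 0 c)
  deriv_zero : derivWithin u (Ico 0 c) 0 = 0
  ode : ∀ r ∈ Ioo 0 c,
    deriv (deriv u) r / (1 + deriv u r ^ 2) ^ (3 / 2 : ℝ)
      + 1 / r * (deriv u r / √(1 + deriv u r ^ 2)) = a * r ^ 2 + b

/-- `u` is a solution with maximal interval of definition `[0, c)`. -/
def IsMaximalProfile (a b c : ℝ) (u : ℝ → ℝ) : Prop :=
  IsProfile a b c u ∧ ∀ (c' : ℝ) (w : ℝ → ℝ), IsProfile a b c' w → EqOn w u (Ico 0 c) → c' ≤ c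

/-- The surface obtained by rotating the graph of `u` on `[0, c)` about the `x₃`-axis, reflecting
the result about the plane `x₃ = z`, and adding the circle of radius `c` in that plane (the rotated
end point of the graph). -/
def closedSurfaceOfRevolution (u : ℝ → ℝ) (c z : ℝ) : Set E3 :=
  {x | axisDist x < c ∧ (x 2 = u (axisDist x) ∨ x 2 = 2 * z - u (axisDist x))} ∪
    {x | axisDist x = c ∧ x 2 = z}

end

/-! Rotation about the vertical axis breaks the invariance of the energy under horizontal
translations, so the translation function N₁ is a natural candidate for a destabilizing direction.
On any surface, Δ N + |σ|² N is minus the tangential gradient of 2H. With 2H = a r² + b, the first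
component reads Δ N₁ + |σ|² N₁ = -2a x₁ + 2a (h - x₃ N₃) N₁, that is, L[N₁] = -2a x₁.

The profile equation multiplied by r is (r u' / √(1 + u'²))' = a r³ + b r. Integrating from the axis
gives u' / √(1 + u'²) = r κ with κ = a r² / 4 + b / 2 (`IsProfile.deriv_div_sqrt`). Hence u' > 0,
and on both sheets the horizontal part of the Gauss map is the polynomial field -κ (x₁, x₂); the
sign is forced by H > 0 (`IsStationaryRotatingSurface.isRotationalNormal`). The proof obtains L[N₁]
= -2a x₁ by direct computation with this polynomial (`IsRotationalNormal.jacobiOperator_eq`), so it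
needs no third derivative of u and no Codazzi equation.

Finally N₁ L[N₁] = 2a κ x₁². In polar coordinates dM = r √(1 + u'²) dr dθ, and r √(1 + u'²) κ = u'.
Each sheet therefore contributes 2a π ∫ r² u' dr, and N₁ has mean zero because cos does. Poles,
equator and the slit of the polar coordinates are null sets. As dM is a Hausdorff measure, the
change of variables rests on an area formula, proved first
(`integral_image_euclideanHausdorffMeasure`). -/

/-! ### An area formula for injective immersions into Euclidean spaces -/

section AreaFormula

open Measure
open scoped NNReal ENNReal

/-- If `f` expands distances at most `K` times more than `g` does, then the images under `f` are
at most `K ^ d` times larger than the images under `g`. -/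
theorem euclideanHausdorffMeasure_image_le_of_edist_le {E F G : Type*} [Nonempty E]
    [EMetricSpace F] [MeasurableSpace F] [BorelSpace F]
    [EMetricSpace G] [MeasurableSpace G] [BorelSpace G] {f : E → F} {g : E → G} {S : Set E}
    {K : ℝ≥0} (d : ℕ)
    (h : ∀ x ∈ S, ∀ y ∈ S, edist (f x) (f y) ≤ K * edist (g x) (g y)) :
    μHE[d] (f '' S) ≤ (K : ℝ≥0∞) ^ d * μHE[d] (g '' S) := by
  -- Points with the same image under `g` have the same image under `f`, so `f` factors through `g`
  -- on `S`, by a `K`-Lipschitz map.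
  have hinv : ∀ x ∈ S, f (Function.invFunOn g S (g x)) = f x := by
    intro x hx
    have hm : Function.invFunOn g S (g x) ∈ S := Function.invFunOn_mem ⟨x, hx, rfl⟩
    have he : g (Function.invFunOn g S (g x)) = g x := Function.invFunOn_eq ⟨x, hx, rfl⟩
    have := h _ hm _ hx
    rw [he, edist_self, mul_zero] at this
    exact edist_le_zero.1 this
  have hlip : LipschitzOnWith K (fun z => f (Function.invFunOn g S z)) (g '' S) := by
    rintro _ ⟨x, hx, rfl⟩ _ ⟨y, hy, rfl⟩
    simp only [hinv x hx, hinv y hy]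
    exact h x hx y hy
  have himg : f '' S = (fun z => f (Function.invFunOn g S z)) '' (g '' S) := by
    rw [image_image]
    exact image_congr fun x hx => (hinv x hx).symm
  have := hlip.hausdorffMeasure_image_le (d := d) (by positivity)
  rw [euclideanHausdorffMeasure_def, euclideanHausdorffMeasure_def, Measure.smul_apply,
    Measure.smul_apply, himg, ENNReal.smul_def, ENNReal.smul_def, smul_eq_mul, smul_eq_mul,
    mul_left_comm]
  rw [ENNReal.rpow_natCast] at this
  gcongr

/-- An inequality between measures that holds locally on a set carrying both holds globally. -/
theorem measure_le_smul_of_locally {α : Type*} [TopologicalSpace α] [SecondCountableTopology α]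
    [MeasurableSpace α] [BorelSpace α] {μ ν : Measure α} {V : Set α} {C : ℝ≥0∞}
    (hV : μ Vᶜ = 0)
    (h : ∀ y ∈ V, ∃ B ∈ 𝓝 y, ∀ S ⊆ B, MeasurableSet S → μ S ≤ C * ν S) : μ ≤ C • ν := by
  have h' : ∀ y : α, ∃ B : Set α, IsOpen B ∧ (y ∈ V → y ∈ B) ∧
      ∀ S ⊆ B, MeasurableSet S → μ S ≤ C * ν S := by
    intro y
    by_cases hy : y ∈ V
    · obtain ⟨B, hB, hS⟩ := h y hy
      obtain ⟨B', hB'B, hB'o, hyB'⟩ := mem_nhds_iff.1 hB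
      exact ⟨B', hB'o, fun _ => hyB', fun S hSB => hS S (hSB.trans hB'B)⟩
    · exact ⟨∅, isOpen_empty, fun h => absurd h hy, fun S hS _ => by
        rw [subset_empty_iff.1 hS]; simp⟩
  choose B hBo hyB hB using h'
  obtain ⟨t, -, ht, hVt⟩ := TopologicalSpace.countable_cover_nhdsWithin (f := B) (s := V)
    fun x hx => mem_nhdsWithin_of_mem_nhds ((hBo x).mem_nhds (hyB x hx))
  refine Measure.le_iff.2 fun S hS => ?_
  rcases t.eq_empty_or_nonempty with rfl | hne
  · have hV' : V = ∅ := by simpa [subset_empty_iff] using hVt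
    have : μ S = 0 := measure_mono_null (fun x _ => by simp [hV']) hV
    simp [this]
  obtain ⟨e, rfl⟩ := ht.exists_eq_range hne
  have hm : ∀ n, MeasurableSet (S ∩ disjointed (fun n => B (e n)) n) := fun n =>
    hS.inter (MeasurableSet.disjointed (fun n => (hBo (e n)).measurableSet) n)
  have hd : Pairwise (Function.onFun Disjoint fun n => S ∩ disjointed (fun n => B (e n)) n) :=
    fun i j hij => ((disjoint_disjointed _ hij).mono inter_subset_right inter_subset_right)
  have hcov : V ⊆ ⋃ n, disjointed (fun n => B (e n)) n := by
    rw [iUnion_disjointed]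
    simpa using hVt
  calc μ S ≤ μ (⋃ n, S ∩ disjointed (fun n => B (e n)) n) + μ Vᶜ := by
        refine (measure_mono fun x hx => ?_).trans (measure_union_le _ _)
        by_cases hxV : x ∈ V
        · left
          rw [← inter_iUnion]
          exact ⟨hx, hcov hxV⟩
        · exact Or.inr hxV
    _ = ∑' n, μ (S ∩ disjointed (fun n => B (e n)) n) := by
        rw [hV, add_zero, measure_iUnion hd hm]
    _ ≤ ∑' n, C * ν (S ∩ disjointed (fun n => B (e n)) n) :=
        ENNReal.tsum_le_tsum fun n =>
          hB _ _ (inter_subset_right.trans (disjointed_subset _ n)) (hm n)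
    _ = C * ν (⋃ n, S ∩ disjointed (fun n => B (e n)) n) := by
        rw [ENNReal.tsum_mul_left, measure_iUnion hd hm]
    _ ≤ C * ν S := by
        gcongr
        exact iUnion_subset fun n => inter_subset_left

theorem measure_le_of_forall_one_lt_smul {α : Type*} [MeasurableSpace α] {μ ν : Measure α} (n : ℕ)
    (h : ∀ K : ℝ≥0, 1 < K → μ ≤ ((K : ℝ≥0∞) ^ n) • ν) : μ ≤ ν := by
  refine Measure.le_iff.2 fun S hS => ?_
  have hlim : Tendsto (fun K : ℝ≥0 => (K : ℝ≥0∞) ^ n * ν S) (𝓝[>] 1) (𝓝 (1 * ν S)) := by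
    refine ENNReal.Tendsto.mul_const ?_ (Or.inl one_ne_zero)
    have : Continuous fun K : ℝ≥0 => ((K ^ n : ℝ≥0) : ℝ≥0∞) := by fun_prop
    have h1 := (this.tendsto 1).mono_left (nhdsWithin_le_nhds (s := Ioi 1))
    simpa using h1
  rw [one_mul] at hlim
  refine ge_of_tendsto hlim ?_
  filter_upwards [self_mem_nhdsWithin] with K hK
  exact Measure.le_iff'.1 (h K hK) S

/-- Near a point where the derivative of `X` has the same norms as an invertible matrix `A`,
the map `X` and the matrix `A` distort distances in nearly the same way. -/
theorem exists_nhds_edist_le_of_norm_fderiv_eq {E F : Type*}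
    [NormedAddCommGroup E] [NormedSpace ℝ E] [FiniteDimensional ℝ E]
    [NormedAddCommGroup F] [NormedSpace ℝ F]
    {X : E → F} {y : E} {X' : E →L[ℝ] F} {A : E →L[ℝ] E} (hX : HasStrictFDerivAt X X' y)
    (hnorm : ∀ v, ‖X' v‖ = ‖A v‖) (hdet : A.det ≠ 0) {K : ℝ≥0} (hK : 1 < K) :
    ∃ B ∈ 𝓝 y, ∀ x ∈ B, ∀ x' ∈ B, edist (X x) (X x') ≤ K * edist (A x) (A x') ∧
      edist (A x) (A x') ≤ K * edist (X x) (X x') := by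
  have hK' : (1 : ℝ) < K := by exact_mod_cast hK
  set A' := A.toContinuousLinearEquivOfDetNeZero hdet
  have hA' : ∀ v, A' v = A v := fun v => rfl
  obtain ⟨c, hc0, hc⟩ : ∃ c > 0, ∀ v, ‖v‖ ≤ c * ‖A v‖ := by
    refine ⟨‖(A'.symm : E →L[ℝ] E)‖ + 1, by positivity, fun v => ?_⟩
    calc ‖v‖ = ‖(A'.symm : E →L[ℝ] E) (A v)‖ := by
          rw [← hA']; simp
      _ ≤ ‖(A'.symm : E →L[ℝ] E)‖ * ‖A v‖ := ContinuousLinearMap.le_opNorm _ _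
      _ ≤ _ := by gcongr; linarith
  -- This `η` makes both estimates close: K (1 - η) = 1, and 1 + η ≤ K because (K - 1)² / K ≥ 0.
  set η : ℝ := 1 - 1 / K with hη
  have hη0 : 0 < η := by
    have : 1 / (K : ℝ) < 1 := by rw [div_lt_one] <;> linarith
    linarith
  have hη1 : 1 + η ≤ K := by
    have : 0 ≤ ((K : ℝ) - 1) ^ 2 / K := by positivity
    have h2 : ((K : ℝ) - 1) ^ 2 / K = K - (1 + η) := by rw [hη]; field_simp; ring
    linarith
  have hη2 : K * (1 - η) = 1 := by
    rw [hη]; field_simp; ring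
  -- Dividing by `c` turns an error relative to ‖v‖ into an error `η` relative to ‖A v‖.
  obtain ⟨B, hB, happ⟩ := hX.approximates_deriv_on_nhds (c := (η / c).toNNReal)
    (Or.inr (by rw [Real.toNNReal_pos]; positivity))
  refine ⟨B, hB, fun x hx x' hx' => ?_⟩
  have h1 : ‖X x - X x' - X' (x - x')‖ ≤ η * ‖A (x - x')‖ := by
    refine (happ x hx x' hx').trans ?_
    rw [Real.coe_toNNReal _ (by positivity)]
    calc η / c * ‖x - x'‖ ≤ η / c * (c * ‖A (x - x')‖) := by gcongr; exact hc _
      _ = _ := by field_simp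
  have h2 : ‖X x - X x'‖ ≤ K * ‖A (x - x')‖ := by
    calc ‖X x - X x'‖ ≤ ‖X x - X x' - X' (x - x')‖ + ‖X' (x - x')‖ := by
          simpa using norm_add_le (X x - X x' - X' (x - x')) (X' (x - x'))
      _ ≤ η * ‖A (x - x')‖ + ‖A (x - x')‖ := by rw [hnorm]; gcongr
      _ = (1 + η) * ‖A (x - x')‖ := by ring
      _ ≤ _ := by gcongr
  have h3 : ‖A (x - x')‖ ≤ K * ‖X x - X x'‖ := by
    have : ‖A (x - x')‖ ≤ ‖X x - X x'‖ + η * ‖A (x - x')‖ := by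
      rw [← hnorm] at h1 ⊢
      have := norm_sub_norm_le (X' (x - x')) (X x - X x')
      rw [norm_sub_rev (X' (x - x'))] at this
      linarith
    calc ‖A (x - x')‖ = K * ((1 - η) * ‖A (x - x')‖) := by rw [← mul_assoc, hη2, one_mul]
      _ ≤ _ := by gcongr; linarith
  rw [map_sub] at h2 h3
  simp only [edist_eq_enorm_sub]
  simp only [enorm_eq_nnnorm, ← ENNReal.coe_mul, ENNReal.coe_le_coe]
  exact ⟨by exact_mod_cast h2, by exact_mod_cast h3⟩

variable {d : ℕ} {F : Type*} [NormedAddCommGroup F] [NormedSpace ℝ F] [MeasurableSpace F]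
  [BorelSpace F] {X : EuclideanSpace ℝ (Fin d) → F}
  {X' : EuclideanSpace ℝ (Fin d) → EuclideanSpace ℝ (Fin d) →L[ℝ] F}
  {A : EuclideanSpace ℝ (Fin d) → EuclideanSpace ℝ (Fin d) →L[ℝ] EuclideanSpace ℝ (Fin d)}
  {V : Set (EuclideanSpace ℝ (Fin d))}

/-- The measure `S ↦ μHE[d] (X '' (V ∩ S))` has density `|det A|`. -/
theorem map_comap_domRestrict_eq_withDensity (hV : IsOpen V)
    (hX : ∀ y ∈ V, HasStrictFDerivAt X (X' y) y) (hnorm : ∀ y ∈ V, ∀ v, ‖X' y v‖ = ‖A y v‖)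
    (hdet : ∀ y ∈ V, (A y).det ≠ 0) (hcont : ContinuousOn (fun y => (A y).det) V)
    (hinj : InjOn X V) :
    ((μHE[d] : Measure F).comap (V.domRestrict X)).map Subtype.val
      = (volume.restrict V).withDensity fun y => ENNReal.ofReal |(A y).det| := by
  have hXc : ContinuousOn X V := fun y hy => (hX y hy).continuousAt.continuousWithinAt
  have hemb : MeasurableEmbedding (V.domRestrict X) :=
    hXc.measurableEmbedding hV.measurableSet hinj
  set ν := ((μHE[d] : Measure F).comap (V.domRestrict X)).map Subtype.val with hν
  set lam := (volume.restrict V).withDensity fun y => ENNReal.ofReal |(A y).det| with hlam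
  have hνS : ∀ S, MeasurableSet S → ν S = μHE[d] (X '' (V ∩ S)) := by
    intro S hS
    rw [hν, Measure.map_apply measurable_subtype_coe hS, hemb.comap_apply]
    congr 1
    ext z
    simp only [mem_image, mem_preimage, domRestrict_apply, Subtype.exists, mem_inter_iff]
    constructor
    · rintro ⟨a, b, h1, h2⟩; exact ⟨a, ⟨b, h1⟩, h2⟩
    · rintro ⟨a, ⟨b, h1⟩, h2⟩; exact ⟨a, b, h1, h2⟩
  have hνV : ν Vᶜ = 0 := by
    rw [hνS _ hV.measurableSet.compl]; simp
  have hlamV : lam Vᶜ = 0 := by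
    refine (withDensity_absolutelyContinuous _ _) ?_
    rw [Measure.restrict_apply hV.measurableSet.compl]; simp
  -- Of the d + 1 factors `K`, d come from the distortion of distances and one from the oscillation
  -- of |det A| near `y`. Letting K decrease to 1 identifies the two measures.
  have key : ∀ K : ℝ≥0, 1 < K → ∀ y ∈ V, ∃ B ∈ 𝓝 y, ∀ S ⊆ B, MeasurableSet S →
      ν S ≤ (K : ℝ≥0∞) ^ (d + 1) * lam S ∧ lam S ≤ (K : ℝ≥0∞) ^ (d + 1) * ν S := by
    intro K hK y hy
    obtain ⟨B, hB, hBd⟩ := exists_nhds_edist_le_of_norm_fderiv_eq (hX y hy) (hnorm y hy)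
      (hdet y hy) hK
    have hK' : (1 : ℝ) < K := by exact_mod_cast hK
    have hJ0 : 0 < |(A y).det| := abs_pos.2 (hdet y hy)
    have hJc : ContinuousAt (fun z => |(A z).det|) y := ((hcont.continuousAt (hV.mem_nhds hy))).abs
    have hJ1 : ∀ᶠ z in 𝓝 y, |(A z).det| < K * |(A y).det| :=
      hJc.eventually_lt continuousAt_const (by nlinarith)
    have hJ2 : ∀ᶠ z in 𝓝 y, |(A y).det| < K * |(A z).det| :=
      continuousAt_const.eventually_lt (hJc.const_mul _) (by nlinarith)
    refine ⟨B ∩ V ∩ {z | |(A z).det| < K * |(A y).det| ∧ |(A y).det| < K * |(A z).det|},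
      inter_mem (inter_mem hB (hV.mem_nhds hy)) (hJ1.and hJ2), fun S hS hSm => ?_⟩
    have hSV : S ⊆ V := fun z hz => (hS hz).1.2
    have hSB : S ⊆ B := fun z hz => (hS hz).1.1
    have e1 : ν S ≤ (K : ℝ≥0∞) ^ d * (ENNReal.ofReal |(A y).det| * volume S) := by
      rw [hνS S hSm, inter_eq_right.2 hSV]
      refine (euclideanHausdorffMeasure_image_le_of_edist_le d
        fun x hx x' hx' => (hBd x (hSB hx) x' (hSB hx')).1).trans ?_
      rw [EuclideanSpace.euclideanHausdorffMeasure_eq_volume, addHaar_image_continuousLinearMap]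
    have e2 : ENNReal.ofReal |(A y).det| * volume S ≤ (K : ℝ≥0∞) ^ d * ν S := by
      rw [hνS S hSm, inter_eq_right.2 hSV]
      refine le_trans (le_of_eq ?_) (euclideanHausdorffMeasure_image_le_of_edist_le d
        fun x hx x' hx' => (hBd x (hSB hx) x' (hSB hx')).2)
      rw [EuclideanSpace.euclideanHausdorffMeasure_eq_volume, addHaar_image_continuousLinearMap]
    have hlamS : lam S = ∫⁻ z in S, ENNReal.ofReal |(A z).det| := by
      rw [hlam, withDensity_apply _ hSm, Measure.restrict_restrict hSm, inter_eq_left.2 hSV]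
    have e3 : lam S ≤ K * (ENNReal.ofReal |(A y).det| * volume S) := by
      rw [hlamS, ← mul_assoc, ← setLIntegral_const]
      refine setLIntegral_mono' hSm fun z hz => ?_
      rw [← ENNReal.ofReal_coe_nnreal, ← ENNReal.ofReal_mul (by positivity)]
      exact ENNReal.ofReal_le_ofReal (hS hz).2.1.le
    have e4 : ENNReal.ofReal |(A y).det| * volume S ≤ K * lam S := by
      rw [hlamS, ← lintegral_const_mul' _ _ ENNReal.coe_ne_top, ← setLIntegral_const]
      refine setLIntegral_mono' hSm fun z hz => ?_
      rw [← ENNReal.ofReal_coe_nnreal, ← ENNReal.ofReal_mul (by positivity)]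
      exact ENNReal.ofReal_le_ofReal (hS hz).2.2.le
    constructor
    · calc ν S ≤ (K : ℝ≥0∞) ^ d * (ENNReal.ofReal |(A y).det| * volume S) := e1
        _ ≤ (K : ℝ≥0∞) ^ d * (K * lam S) := by gcongr
        _ = _ := by ring
    · calc lam S ≤ K * (ENNReal.ofReal |(A y).det| * volume S) := e3
        _ ≤ K * ((K : ℝ≥0∞) ^ d * ν S) := by gcongr
        _ = _ := by ring
  refine le_antisymm ?_ ?_
  · refine measure_le_of_forall_one_lt_smul (d + 1) fun K hK =>
      measure_le_smul_of_locally hνV fun y hy => ?_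
    obtain ⟨B, hB, h⟩ := key K hK y hy
    exact ⟨B, hB, fun S hS hSm => (h S hS hSm).1⟩
  · refine measure_le_of_forall_one_lt_smul (d + 1) fun K hK =>
      measure_le_smul_of_locally hlamV fun y hy => ?_
    obtain ⟨B, hB, h⟩ := key K hK y hy
    exact ⟨B, hB, fun S hS hSm => (h S hS hSm).2⟩

/-- **Area formula** for an injective immersion `X` on an open set `V`, whose Jacobian is given by
square matrices `A` such that `‖DX v‖ = ‖A v‖`. -/
theorem integral_image_euclideanHausdorffMeasure (hV : IsOpen V)
    (hX : ∀ y ∈ V, HasStrictFDerivAt X (X' y) y) (hnorm : ∀ y ∈ V, ∀ v, ‖X' y v‖ = ‖A y v‖)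
    (hdet : ∀ y ∈ V, (A y).det ≠ 0) (hcont : ContinuousOn (fun y => (A y).det) V)
    (hinj : InjOn X V) (f : F → ℝ) :
    ∫ x in X '' V, f x ∂μHE[d] = ∫ y in V, |(A y).det| * f (X y) ∧
    (IntegrableOn f (X '' V) μHE[d] ↔ IntegrableOn (fun y => |(A y).det| * f (X y)) V) := by
  have hXc : ContinuousOn X V := fun y hy => (hX y hy).continuousAt.continuousWithinAt
  have hemb : MeasurableEmbedding (V.domRestrict X) :=
    hXc.measurableEmbedding hV.measurableSet hinj
  have hval : MeasurableEmbedding (Subtype.val : V → _) :=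
    MeasurableEmbedding.subtype_coe hV.measurableSet
  have hrestr : (μHE[d] : Measure F).restrict (X '' V)
      = ((μHE[d] : Measure F).comap (V.domRestrict X)).map (V.domRestrict X) := by
    rw [hemb.map_comap, range_domRestrict]
  have hmain := map_comap_domRestrict_eq_withDensity hV hX hnorm hdet hcont hinj
  have hmeas : AEMeasurable (fun y => ENNReal.ofReal |(A y).det|) (volume.restrict V) :=
    (hcont.abs.aemeasurable hV.measurableSet).ennreal_ofReal
  have hfin : ∀ᵐ y ∂(volume.restrict V), ENNReal.ofReal |(A y).det| < ⊤ := by simp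
  constructor
  · rw [hrestr, hemb.integral_map]
    have h1 := hval.integral_map (μ := (μHE[d] : Measure F).comap (V.domRestrict X))
      (fun y => f (X y))
    rw [hmain, integral_withDensity_eq_integral_toReal_smul₀ hmeas hfin] at h1
    simp only [domRestrict_apply]
    rw [← h1]
    simp
  · rw [IntegrableOn, IntegrableOn, hrestr, hemb.integrable_map_iff]
    have h1 := hval.integrable_map_iff (μ := (μHE[d] : Measure F).comap (V.domRestrict X))
      (g := fun y => f (X y))
    rw [hmain, integrable_withDensity_iff_integrable_smul₀' hmeas hfin] at h1
    simp only [ENNReal.toReal_ofReal (abs_nonneg _), smul_eq_mul] at h1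
    rw [h1]
    rfl

end AreaFormula

/-! ### The profile curve -/

section Profile

/-- The normal curvature in the direction of the parallels, as a function of `ρ = r²`, of the
surface generated by a profile. -/
noncomputable def parallelCurvature (a b ρ : ℝ) : ℝ := a * ρ / 4 + b / 2

variable {a b c : ℝ} {u : ℝ → ℝ}

theorem parallelCurvature_pos (ha : 0 < a) (hb : 0 ≤ b) {ρ : ℝ} (hρ : 0 < ρ) :
    0 < parallelCurvature a b ρ := by
  unfold parallelCurvature; positivity

/-- With v = u', this exhibits the first term of the profile equation as an exact derivative. -/
theorem hasDerivAt_div_sqrt_one_add_sq {v : ℝ → ℝ} {v' r : ℝ} (hv : HasDerivAt v v' r) :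
    HasDerivAt (fun t => v t / √(1 + v t ^ 2)) (v' / (1 + v r ^ 2) ^ (3 / 2 : ℝ)) r := by
  have hp : 0 < 1 + v r ^ 2 := by positivity
  have hs : 0 < √(1 + v r ^ 2) := Real.sqrt_pos.2 hp
  have hss : √(1 + v r ^ 2) ^ 2 = 1 + v r ^ 2 := Real.sq_sqrt hp.le
  have h1 : HasDerivAt (fun t => 1 + v t ^ 2) (2 * v r * v') r := by
    simpa using (hv.pow 2).const_add 1
  have h2 := hv.div (h1.sqrt hp.ne') hs.ne'
  refine h2.congr_deriv ?_
  have h3 : (1 + v r ^ 2) ^ (3 / 2 : ℝ) = (1 + v r ^ 2) * √(1 + v r ^ 2) := by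
    rw [Real.sqrt_eq_rpow, show (3 / 2 : ℝ) = 1 + 1 / 2 by norm_num, Real.rpow_add hp,
      Real.rpow_one]
  rw [h3, hss]
  field_simp
  rw [hss]
  ring

theorem IsProfile.contDiffAt (hu : IsProfile a b c u) {r : ℝ} (hr : r ∈ Ioo 0 c) :
    ContDiffAt ℝ 2 u r :=
  hu.contDiffOn.contDiffAt (Ico_mem_nhds hr.1 hr.2)

theorem IsProfile.hasStrictDerivAt (hu : IsProfile a b c u) {r : ℝ} (hr : r ∈ Ioo 0 c) :
    HasStrictDerivAt u (deriv u r) r :=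
  (hu.contDiffAt hr).hasStrictDerivAt (by norm_num)

theorem IsProfile.contDiffOn_deriv (hu : IsProfile a b c u) :
    ContDiffOn ℝ 1 (deriv u) (Ioo 0 c) :=
  ((contDiffOn_succ_iff_deriv_of_isOpen (n := 1) isOpen_Ioo).1
    (by simpa using! hu.contDiffOn.mono Ioo_subset_Ico_self)).2.2

theorem IsProfile.continuousOn_deriv (hu : IsProfile a b c u) :
    ContinuousOn (deriv u) (Ioo 0 c) := hu.contDiffOn_deriv.continuousOn

/-- The first integral of the profile equation. -/
theorem IsProfile.deriv_div_sqrt (hu : IsProfile a b c u) {r : ℝ} (hr : r ∈ Ioo 0 c) :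
    deriv u r / √(1 + deriv u r ^ 2) = r * parallelCurvature a b (r ^ 2) := by
  set F : ℝ → ℝ := fun r => r * (deriv u r / √(1 + deriv u r ^ 2)) -
    (a * r ^ 4 / 4 + b * r ^ 2 / 2) with hF
  have hderiv : ∀ r ∈ Ioo 0 c, HasDerivAt F 0 r := by
    intro r hr
    have hv : HasDerivAt (deriv u) (deriv (deriv u) r) r :=
      ((hu.contDiffOn_deriv.contDiffAt (isOpen_Ioo.mem_nhds hr)).differentiableAt
        (by norm_num)).hasDerivAt
    have h1 := (hasDerivAt_id r).mul (hasDerivAt_div_sqrt_one_add_sq hv)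
    have h2 : HasDerivAt (fun r : ℝ => a * r ^ 4 / 4 + b * r ^ 2 / 2) (a * r ^ 3 + b * r) r := by
      have := (((hasDerivAt_pow 4 r).const_mul a).div_const 4).add
        (((hasDerivAt_pow 2 r).const_mul b).div_const 2)
      exact this.congr_deriv (by push_cast; ring)
    refine (h1.sub h2).congr_deriv ?_
    have ho := hu.ode r hr
    have hr0 : r ≠ 0 := hr.1.ne'
    have : a * r ^ 3 + b * r = r * (a * r ^ 2 + b) := by ring
    rw [this, ← ho]
    simp only [id]
    field_simp
    ring
  have hconst : ∀ s ∈ Ioo 0 c, F s = F r := by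
    intro s hs
    refine (convex_Ioo 0 c).is_const_of_fderivWithin_eq_zero (𝕜 := ℝ)
      (fun x hx => (hderiv x hx).differentiableAt.differentiableWithinAt) (fun x hx => ?_) hs hr
    rw [fderivWithin_of_isOpen isOpen_Ioo hx]
    ext
    simp [(hderiv x hx).deriv]
  -- The constant of integration is zero: |u'| / √(1 + u'²) ≤ 1, so the factor r alone sends the
  -- first term to 0 at the axis.
  have hlim : Tendsto F (𝓝[>] 0) (𝓝 0) := by
    have h1 : Tendsto (fun r : ℝ => r * (deriv u r / √(1 + deriv u r ^ 2))) (𝓝[>] 0) (𝓝 0) := by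
      have hid : Tendsto (fun r : ℝ => r) (𝓝[>] 0) (𝓝 0) := tendsto_id.mono_left nhdsWithin_le_nhds
      refine hid.zero_mul_isBoundedUnder_le ⟨1, ?_⟩
      simp only [eventually_map]
      refine Eventually.of_forall fun r => ?_
      simp only [Function.comp, Real.norm_eq_abs, abs_div, abs_of_nonneg (Real.sqrt_nonneg _)]
      rw [div_le_one (Real.sqrt_pos.2 (by positivity))]
      exact Real.abs_le_sqrt (by linarith)
    have h2 : Tendsto (fun r : ℝ => a * r ^ 4 / 4 + b * r ^ 2 / 2) (𝓝[>] 0) (𝓝 0) := by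
      have : Continuous fun r : ℝ => a * r ^ 4 / 4 + b * r ^ 2 / 2 := by fun_prop
      simpa using (this.tendsto 0).mono_left (nhdsWithin_le_nhds (s := Ioi 0))
    simpa [hF] using h1.sub h2
  have hFr : F r = 0 := by
    refine tendsto_nhds_unique (tendsto_const_nhds.congr' ?_) hlim
    filter_upwards [Ioo_mem_nhdsGT hu.pos] with s hs using (hconst s hs).symm
  have hr0 : r ≠ 0 := hr.1.ne'
  have h3 : r * (deriv u r / √(1 + deriv u r ^ 2)) = r * (r * parallelCurvature a b (r ^ 2)) := by
    simp only [hF] at hFr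
    unfold parallelCurvature
    linear_combination hFr
  exact mul_left_cancel₀ hr0 h3

theorem IsProfile.deriv_pos (hu : IsProfile a b c u) (ha : 0 < a) (hb : 0 ≤ b) {r : ℝ}
    (hr : r ∈ Ioo 0 c) : 0 < deriv u r := by
  have h := hu.deriv_div_sqrt hr
  have hr0 := hr.1
  have h1 : 0 < r * parallelCurvature a b (r ^ 2) :=
    mul_pos hr.1 (parallelCurvature_pos ha hb (by positivity))
  rw [← h] at h1
  exact (div_pos_iff_of_pos_right (Real.sqrt_pos.2 (by positivity))).1 h1

theorem IsProfile.strictMonoOn (hu : IsProfile a b c u) (ha : 0 < a) (hb : 0 ≤ b) :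
    StrictMonoOn u (Ico 0 c) :=
  strictMonoOn_of_deriv_pos (convex_Ico 0 c) hu.contDiffOn.continuousOn fun r hr =>
    hu.deriv_pos ha hb (by simpa using hr)

theorem axisDist_nonneg (x : E3) : 0 ≤ axisDist x := Real.sqrt_nonneg _

theorem sq_axisDist (x : E3) : axisDist x ^ 2 = x 0 ^ 2 + x 1 ^ 2 := Real.sq_sqrt (by positivity)

theorem continuous_axisDist : Continuous axisDist := by
  unfold axisDist; fun_prop

/-- If the surface of revolution is compact, then the profile stays below the plane of
reflection. -/
theorem IsProfile.lt_of_isCompact {z : ℝ} (hu : IsProfile a b c u) (ha : 0 < a) (hb : 0 ≤ b)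
    (hM : IsCompact (closedSurfaceOfRevolution u c z)) {r : ℝ} (hr : r ∈ Ico 0 c) : u r < z := by
  have hmono := hu.strictMonoOn ha hb
  have hmem : ∀ s ∈ Ico 0 c, !₂[s, 0, u s] ∈ closedSurfaceOfRevolution u c z := by
    intro s hs
    have : axisDist !₂[s, 0, u s] = s := by simp [axisDist, Real.sqrt_sq hs.1]
    exact Or.inl ⟨by rw [this]; exact hs.2, Or.inl (by rw [this]; simp)⟩
  have hbdd : BddAbove (u '' Ioo 0 c) := by
    obtain ⟨B, hB⟩ := hM.isBounded.exists_norm_le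
    refine ⟨B, ?_⟩
    rintro _ ⟨s, hs, rfl⟩
    have h1 := hB _ (hmem s (Ioo_subset_Ico_self hs))
    have h2 := PiLp.norm_apply_le !₂[s, 0, u s] 2
    simp at h2
    exact (le_abs_self _).trans (h2.trans h1)
  have hlim : Tendsto u (𝓝[<] c) (𝓝 (sSup (u '' Ioo 0 c))) :=
    (hmono.monotoneOn.mono Ioo_subset_Ico_self).tendsto_nhdsWithin_Ioo_left
      (nonempty_Ioo.2 hu.pos) hbdd
  set L := sSup (u '' Ioo 0 c)
  have hcurve : Tendsto (fun s => (!₂[s, 0, u s] : E3)) (𝓝[<] c) (𝓝 !₂[c, 0, L]) := by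
    refine ((PiLp.continuous_toLp 2 _).tendsto _).comp (tendsto_pi_nhds.2 fun i => ?_)
    fin_cases i
    · exact tendsto_id.mono_left nhdsWithin_le_nhds
    · exact tendsto_const_nhds
    · exact hlim
  -- The end point of the profile curve is a limit of points of the closed set; lying at distance
  -- `c` from the axis, it can only be on the added circle, whence L = z.
  have hL : !₂[c, 0, L] ∈ closedSurfaceOfRevolution u c z := by
    refine hM.isClosed.mem_of_tendsto hcurve ?_
    filter_upwards [Ioo_mem_nhdsLT hu.pos] with s hs using hmem s (Ioo_subset_Ico_self hs)
  have hax : axisDist !₂[c, 0, L] = c := by simp [axisDist, Real.sqrt_sq hu.pos.le]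
  have hLz : L = z := by
    rcases hL with h | h
    · exact absurd h.1 (by rw [hax]; exact lt_irrefl _)
    · simpa using h.2
  rw [← hLz]
  have hs : (r + c) / 2 ∈ Ioo 0 c := ⟨by linarith [hr.1, hr.2], by linarith [hr.2]⟩
  calc u r < u ((r + c) / 2) := hmono hr (Ioo_subset_Ico_self hs) (by linarith [hr.2])
    _ ≤ L := le_csSup hbdd (mem_image_of_mem u hs)

/-- A monotone function on a closed interval has an integrable derivative, even if u' blows up at
`c`. Giving the profile the value `z` from `c` on keeps it monotone on [0, c]. -/
theorem IsProfile.integrableOn_pow_mul_deriv {z : ℝ} (hu : IsProfile a b c u) (ha : 0 < a)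
    (hb : 0 ≤ b) (hz : ∀ r ∈ Ico 0 c, u r < z) (n : ℕ) :
    IntegrableOn (fun r => r ^ n * deriv u r) (Ioo 0 c) := by
  have hz0 : MonotoneOn (fun r => if r < c then u r else z) (uIcc 0 c) := by
    rw [uIcc_of_le hu.pos.le]
    intro r hr s hs hrs
    by_cases h1 : s < c
    · have h2 : r < c := hrs.trans_lt h1
      simp only [h1, h2, if_true]
      exact (hu.strictMonoOn ha hb).monotoneOn ⟨hr.1, h2⟩ ⟨hs.1, h1⟩ hrs
    · by_cases h2 : r < c
      · simp only [h1, h2, if_true, if_false]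
        exact (hz r ⟨hr.1, h2⟩).le
      · simp [h1, h2]
  have hd : IntegrableOn (deriv u) (Ioo 0 c) := by
    have h1 := hz0.intervalIntegrable_deriv
    rw [intervalIntegrable_iff_integrableOn_Ioo_of_le hu.pos.le] at h1
    refine h1.congr_fun (fun r hr => ?_) measurableSet_Ioo
    refine Filter.EventuallyEq.deriv_eq ?_
    filter_upwards [Iio_mem_nhds hr.2] with s hs
    rw [if_pos (mem_Iio.1 hs)]
  refine hd.bdd_mul (c := c ^ n) (by fun_prop) ?_
  filter_upwards [ae_restrict_mem measurableSet_Ioo] with r hr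
  rw [Real.norm_eq_abs, abs_of_nonneg (pow_nonneg hr.1.le n)]
  exact pow_le_pow_left₀ hr.1.le hr.2.le n

end Profile

/-! ### Tangent vectors and the Gauss map -/

section Tangent

theorem inner_E3 (v w : E3) : inner ℝ v w = v 0 * w 0 + v 1 * w 1 + v 2 * w 2 := by
  simp [PiLp.inner_apply, Fin.sum_univ_three]
  ring

theorem norm_sq_E3 (v : E3) : ‖v‖ ^ 2 = v 0 ^ 2 + v 1 ^ 2 + v 2 ^ 2 := by
  rw [← real_inner_self_eq_norm_sq, inner_E3]
  ring

/-- `τ` is the velocity at `p` of a curve in `M`. -/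
def IsTangentVector (M : Set E3) (p τ : E3) : Prop :=
  ∃ γ : ℝ → E3, γ 0 = p ∧ HasDerivAt γ τ 0 ∧ ∀ᶠ t in 𝓝 0, γ t ∈ M

theorem HasDerivAt.apply_E3 {γ : ℝ → E3} {τ : E3} {t : ℝ} (h : HasDerivAt γ τ t) (i : Fin 3) :
    HasDerivAt (fun t => γ t i) (τ i) t :=
  (EuclideanSpace.proj (𝕜 := ℝ) i).hasFDerivAt.comp_hasDerivAt t h

theorem hasDerivAt_E3_mk {f g h : ℝ → ℝ} {f' g' h' t : ℝ} (hf : HasDerivAt f f' t)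
    (hg : HasDerivAt g g' t) (hh : HasDerivAt h h' t) :
    HasDerivAt (fun t => (!₂[f t, g t, h t] : E3)) !₂[f', g', h'] t := by
  have : HasDerivAt (fun t => ![f t, g t, h t]) ![f', g', h'] t := by
    refine hasDerivAt_pi.2 fun i => ?_
    fin_cases i
    · exact hf
    · exact hg
    · exact hh
  exact (PiLp.continuousLinearEquiv 2 ℝ (fun _ : Fin 3 => ℝ)).symm.hasFDerivAt.comp_hasDerivAt t
    this

variable {M : Set E3} {N : E3 → E3} {p τ : E3}

/-- Differentiation along a curve inside `M` sees only values on `M`. This allows extensions of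
fields on `M` to be exchanged for polynomial ones. -/
theorem IsTangentVector.fderiv_eq {F : Type*} [NormedAddCommGroup F] [NormedSpace ℝ F]
    (hτ : IsTangentVector M p τ) {V W : E3 → F} (hV : DifferentiableAt ℝ V p)
    (hW : DifferentiableAt ℝ W p) (h : ∀ᶠ x in 𝓝 p, x ∈ M → V x = W x) :
    fderiv ℝ V p τ = fderiv ℝ W p τ := by
  obtain ⟨γ, h0, hγ, hM⟩ := hτ
  subst h0
  have h1 := hV.hasFDerivAt.comp_hasDerivAt 0 hγ
  have h2 := hW.hasFDerivAt.comp_hasDerivAt 0 hγ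
  refine h1.unique (h2.congr_of_eventuallyEq ?_)
  filter_upwards [hγ.continuousAt.eventually h, hM] with t ht htM using ht htM

theorem IsClosedOrientedSurface.inner_eq_zero (hM : IsClosedOrientedSurface M N) (hp : p ∈ M)
    (hτ : IsTangentVector M p τ) : inner ℝ (N p) τ = 0 := by
  obtain ⟨U, φ, hU, hpU, hφ, hMU, h⟩ := hM.regular p hp
  refine (h p ⟨hp, hpU⟩).2 τ ?_
  have hd : DifferentiableAt ℝ φ p :=
    (hφ.contDiffAt (hU.mem_nhds hpU)).differentiableAt (by simp)
  rw [hτ.fderiv_eq hd (differentiableAt_const 0)]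
  · simp
  · filter_upwards [hU.mem_nhds hpU] with x hx hxM
    have : x ∈ M ∩ U := ⟨hxM, hx⟩
    rw [hMU] at this
    exact this.2

variable {a b c z : ℝ} {u : ℝ → ℝ}

/-- The sign σ (1 for the lower sheet, -1 for its reflection) lets both sheets be treated by a
single computation. -/
theorem exists_sheet {x : E3} (hx : x ∈ closedSurfaceOfRevolution u c z) (hc : axisDist x < c) :
    ∃ σ : ℝ, (σ = 1 ∨ σ = -1) ∧ x 2 = z + σ * (u (axisDist x) - z) := by
  rcases hx with ⟨-, h | h⟩ | h
  · exact ⟨1, Or.inl rfl, by rw [h]; ring⟩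
  · exact ⟨-1, Or.inr rfl, by rw [h]; ring⟩
  · exact absurd h.1 hc.ne

theorem mem_of_sheet {x : E3} {σ : ℝ} (hc : axisDist x < c) (hσ : σ = 1 ∨ σ = -1)
    (h : x 2 = z + σ * (u (axisDist x) - z)) : x ∈ closedSurfaceOfRevolution u c z := by
  refine Or.inl ⟨hc, ?_⟩
  rcases hσ with rfl | rfl
  · left; rw [h]; ring
  · right; rw [h]; ring

theorem isTangentVector_of_sheet (hu : IsProfile a b c u) (hp : axisDist p ∈ Ioo 0 c) {σ : ℝ}
    (hσ : σ = 1 ∨ σ = -1) (h : p 2 = z + σ * (u (axisDist p) - z))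
    (hτ : τ 2 = σ * (deriv u (axisDist p) * ((p 0 * τ 0 + p 1 * τ 1) / axisDist p))) :
    IsTangentVector (closedSurfaceOfRevolution u c z) p τ := by
  have hr := hp.1
  have hx : HasDerivAt (fun t : ℝ => p 0 + t * τ 0) (τ 0) 0 := by
    simpa using ((hasDerivAt_id (0 : ℝ)).mul_const (τ 0)).const_add (p 0)
  have hy : HasDerivAt (fun t : ℝ => p 1 + t * τ 1) (τ 1) 0 := by
    simpa using ((hasDerivAt_id (0 : ℝ)).mul_const (τ 1)).const_add (p 1)
  set R : ℝ → ℝ := fun t => √((p 0 + t * τ 0) ^ 2 + (p 1 + t * τ 1) ^ 2) with hR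
  have hR0 : R 0 = axisDist p := by simp [hR, axisDist]
  have hRd : HasDerivAt R ((p 0 * τ 0 + p 1 * τ 1) / axisDist p) 0 := by
    have h1 := (hx.pow 2).add (hy.pow 2)
    have h2 : p 0 ^ 2 + p 1 ^ 2 ≠ 0 := by
      rw [← sq_axisDist]; positivity
    have h3 := h1.sqrt (by simpa using h2)
    refine h3.congr_deriv ?_
    simp only [zero_mul, add_zero, Pi.add_apply, Pi.pow_apply]
    rw [show √(p 0 ^ 2 + p 1 ^ 2) = axisDist p from rfl]
    field_simp
    ring
  have hud : HasDerivAt (fun t => z + σ * (u (R t) - z)) (τ 2) 0 := by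
    have h1 : HasDerivAt u (deriv u (axisDist p)) (R 0) := by
      rw [hR0]; exact (hu.hasStrictDerivAt hp).hasDerivAt
    have h2 := (((h1.comp (0 : ℝ) hRd).sub_const z).const_mul σ).const_add z
    rw [hτ]
    exact h2
  -- The curve is the horizontal line through `p` in direction (τ₁, τ₂), lifted to the sheet.
  refine ⟨fun t => !₂[p 0 + t * τ 0, p 1 + t * τ 1, z + σ * (u (R t) - z)], ?_, ?_, ?_⟩
  · ext i
    fin_cases i
    · simp
    · simp
    · simp [hR0, h]
  · convert hasDerivAt_E3_mk hx hy hud using 1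
    ext i
    fin_cases i <;> rfl
  · have hRc : ∀ᶠ t in 𝓝 0, R t < c :=
      hRd.continuousAt.eventually_lt continuousAt_const (by rw [hR0]; exact hp.2)
    filter_upwards [hRc] with t ht
    have hax : axisDist !₂[p 0 + t * τ 0, p 1 + t * τ 1, z + σ * (u (R t) - z)] = R t := by
      simp [axisDist, hR]
    exact mem_of_sheet (by rw [hax]; exact ht) hσ (by rw [hax]; simp)

theorem normal_of_sheet (hu : IsProfile a b c u)
    (hM : IsClosedOrientedSurface (closedSurfaceOfRevolution u c z) N)
    (hp : axisDist p ∈ Ioo 0 c) {σ : ℝ}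
    (hσ : σ = 1 ∨ σ = -1) (h : p 2 = z + σ * (u (axisDist p) - z)) :
    N p 0 = -(σ * N p 2 * deriv u (axisDist p) * p 0 / axisDist p) ∧
    N p 1 = -(σ * N p 2 * deriv u (axisDist p) * p 1 / axisDist p) ∧
    N p 2 ^ 2 * (1 + deriv u (axisDist p) ^ 2) = 1 := by
  have hr := hp.1
  have hpM := mem_of_sheet hp.2 hσ h
  -- Orthogonality to the lifts of e₁ and e₂ determines N₁ and N₂ from N₃; the unit length then
  -- determines N₃².
  have h0 := hM.inner_eq_zero hpM (isTangentVector_of_sheet (τ := !₂[1, 0,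
    σ * (deriv u (axisDist p) * ((p 0 * 1 + p 1 * 0) / axisDist p))]) hu hp hσ h (by simp))
  have h1 := hM.inner_eq_zero hpM (isTangentVector_of_sheet (τ := !₂[0, 1,
    σ * (deriv u (axisDist p) * ((p 0 * 0 + p 1 * 1) / axisDist p))]) hu hp hσ h (by simp))
  rw [inner_E3] at h0 h1
  simp only [Matrix.cons_val_zero, Matrix.cons_val_one, Matrix.cons_val] at h0 h1
  have hn : N p 0 ^ 2 + N p 1 ^ 2 + N p 2 ^ 2 = 1 := by
    rw [← norm_sq_E3, hM.norm_normal p hpM]; norm_num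
  have e0 : N p 0 = -(σ * N p 2 * deriv u (axisDist p) * p 0 / axisDist p) := by
    linear_combination h0
  have e1 : N p 1 = -(σ * N p 2 * deriv u (axisDist p) * p 1 / axisDist p) := by
    linear_combination h1
  refine ⟨e0, e1, ?_⟩
  have hσ2 : σ ^ 2 = 1 := by rcases hσ with rfl | rfl <;> norm_num
  have hρ : p 0 ^ 2 + p 1 ^ 2 = axisDist p ^ 2 := (sq_axisDist p).symm
  rw [e0, e1] at hn
  field_simp at hn
  have hr2 : axisDist p ^ 2 ≠ 0 := by positivity
  apply mul_left_cancel₀ hr2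
  rw [hσ2] at hn
  linear_combination hn - N p 2 ^ 2 * deriv u (axisDist p) ^ 2 * hρ

/-- Away from the axis and the equator, the vectors orthogonal to the Gauss map are velocities of
curves in the surface. -/
theorem isTangentVector_of_inner_eq_zero (hu : IsProfile a b c u)
    (hM : IsClosedOrientedSurface (closedSurfaceOfRevolution u c z) N)
    (hpM : p ∈ closedSurfaceOfRevolution u c z) (hp : axisDist p ∈ Ioo 0 c)
    (hτ : inner ℝ (N p) τ = 0) : IsTangentVector (closedSurfaceOfRevolution u c z) p τ := by
  obtain ⟨σ, hσ, h⟩ := exists_sheet hpM hp.2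
  obtain ⟨h0, h1, h2⟩ := normal_of_sheet hu hM hp hσ h
  refine isTangentVector_of_sheet hu hp hσ h ?_
  have hN : N p 2 ≠ 0 := by
    intro hN
    simp [hN] at h2
  rw [inner_E3, h0, h1] at hτ
  apply mul_left_cancel₀ hN
  linear_combination hτ

/-- Away from the axis and the equator, the Gauss map is one of the two unit normals to the
surface of revolution, written in terms of the curvature of the parallels. -/
theorem exists_normal_eq (hu : IsProfile a b c u) (hz : ∀ r ∈ Ico 0 c, u r < z)
    (hM : IsClosedOrientedSurface (closedSurfaceOfRevolution u c z) N)
    (hpM : p ∈ closedSurfaceOfRevolution u c z) (hp : axisDist p ∈ Ioo 0 c) :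
    ∃ ε : ℝ, (ε = 1 ∨ ε = -1) ∧ 0 < ε * ((z - p 2) * N p 2) ∧
      N p 0 = -ε * (parallelCurvature a b (p 0 ^ 2 + p 1 ^ 2) * p 0) ∧
      N p 1 = -ε * (parallelCurvature a b (p 0 ^ 2 + p 1 ^ 2) * p 1) := by
  obtain ⟨σ, hσ, h⟩ := exists_sheet hpM hp.2
  obtain ⟨h0, h1, h2⟩ := normal_of_sheet hu hM hp hσ h
  have hr := hp.1
  have hint := hu.deriv_div_sqrt hp
  set v := deriv u (axisDist p)
  have hw : 0 < √(1 + v ^ 2) := Real.sqrt_pos.2 (by positivity)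
  have hw2 : √(1 + v ^ 2) ^ 2 = 1 + v ^ 2 := Real.sq_sqrt (by positivity)
  have hσ2 : σ ^ 2 = 1 := by rcases hσ with rfl | rfl <;> norm_num
  have hzu : 0 < z - u (axisDist p) := sub_pos.2 (hz _ (Ioo_subset_Ico_self hp))
  rw [sq_axisDist] at hint
  have hv : v = axisDist p * parallelCurvature a b (p 0 ^ 2 + p 1 ^ 2) * √(1 + v ^ 2) := by
    rw [← hint]; field_simp
  -- The horizontal part of N is -σ N₃ v (x₁, x₂) / r, and v / r = κ √(1 + v²) by the first
  -- integral, so this factor is what multiplies -κ (x₁, x₂). It has the sign of (z - x₃) N₃, since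
  -- z - x₃ = σ (z - u).
  refine ⟨σ * N p 2 * √(1 + v ^ 2), ?_, ?_, ?_, ?_⟩
  · rw [← mul_self_eq_one_iff]
    linear_combination h2 + σ ^ 2 * N p 2 ^ 2 * hw2 + N p 2 ^ 2 * (1 + v ^ 2) * hσ2
  · have : σ * N p 2 * √(1 + v ^ 2) * ((z - p 2) * N p 2) =
        √(1 + v ^ 2) * (z - u (axisDist p)) * (N p 2) ^ 2 := by
      rw [h]
      linear_combination √(1 + v ^ 2) * (z - u (axisDist p)) * (N p 2) ^ 2 * hσ2
    rw [this]
    have hN : N p 2 ≠ 0 := by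
      intro hN
      simp [hN] at h2
    positivity
  · rw [h0]
    field_simp
    linear_combination (-σ * N p 2 * p 0) * hv
  · rw [h1]
    field_simp
    linear_combination (-σ * N p 2 * p 1) * hv

end Tangent

/-! ### Curvatures in terms of the Gauss map -/

section Curvature

theorem tangentPart_single_apply (n : E3) (i j : Fin 3) :
    tangentPart n (EuclideanSpace.single i 1) j = (if j = i then 1 else 0) - n i * n j := by
  simp [tangentPart, EuclideanSpace.inner_single_left]

theorem inner_tangentPart {n : E3} (hn : ‖n‖ = 1) (w : E3) : inner ℝ n (tangentPart n w) = 0 := by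
  rw [tangentPart, inner_sub_right, real_inner_smul_right, real_inner_self_eq_norm_sq, hn,
    real_inner_comm]
  ring

theorem surfaceDiv_eq (N V : E3 → E3) (x : E3) :
    surfaceDiv N V x = ∑ i, fderiv ℝ V x (tangentPart (N x) (EuclideanSpace.single i 1)) i := by
  simp [surfaceDiv, EuclideanSpace.inner_single_right]

theorem fderiv_apply_E3 {V : E3 → E3} {p : E3} (hV : DifferentiableAt ℝ V p) (τ : E3) (i : Fin 3) :
    fderiv ℝ (fun x => V x i) p τ = fderiv ℝ V p τ i := by
  have h := ((EuclideanSpace.proj (𝕜 := ℝ) i).hasFDerivAt.comp p hV.hasFDerivAt).fderiv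
  exact congrArg (fun L : E3 →L[ℝ] ℝ => L τ) h

variable {M : Set E3} {N : E3 → E3} {p τ : E3} {a b ε : ℝ}

theorem IsTangentVector.surfaceDiv_congr {V W : E3 → E3}
    (hT : ∀ τ, inner ℝ (N p) τ = 0 → IsTangentVector M p τ) (hn : ‖N p‖ = 1)
    (hV : DifferentiableAt ℝ V p) (hW : DifferentiableAt ℝ W p)
    (h : ∀ᶠ x in 𝓝 p, x ∈ M → V x = W x) : surfaceDiv N V p = surfaceDiv N W p := by
  simp only [surfaceDiv]
  refine Finset.sum_congr rfl fun i _ => ?_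
  rw [(hT _ (inner_tangentPart hn _)).fderiv_eq hV hW h]

/-- Near `p`, up to the sign `ε` the Gauss map is that of a surface of revolution. -/
structure IsRotationalNormal (a b ε : ℝ) (M : Set E3) (N : E3 → E3) (p : E3) : Prop where
  differentiableAt : DifferentiableAt ℝ N p
  norm_eq_one : ∀ᶠ x in 𝓝 p, x ∈ M → ‖N x‖ = 1
  mem : p ∈ M
  tangent : ∀ τ, inner ℝ (N p) τ = 0 → IsTangentVector M p τ
  vertical_ne_zero : N p 2 ≠ 0
  apply_zero : ∀ᶠ x in 𝓝 p, x ∈ M → N x 0 = -ε * (parallelCurvature a b (x 0 ^ 2 + x 1 ^ 2) * x 0)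
  apply_one : ∀ᶠ x in 𝓝 p, x ∈ M → N x 1 = -ε * (parallelCurvature a b (x 0 ^ 2 + x 1 ^ 2) * x 1)
  sign : ε = 1 ∨ ε = -1

namespace IsRotationalNormal

variable (h : IsRotationalNormal a b ε M N p)
include h

theorem norm_self : ‖N p‖ = 1 := h.norm_eq_one.self_of_nhds h.mem

theorem zero_self : N p 0 = -ε * (parallelCurvature a b (p 0 ^ 2 + p 1 ^ 2) * p 0) :=
  h.apply_zero.self_of_nhds h.mem

theorem one_self : N p 1 = -ε * (parallelCurvature a b (p 0 ^ 2 + p 1 ^ 2) * p 1) :=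
  h.apply_one.self_of_nhds h.mem

theorem apply_two_sq : ∀ᶠ x in 𝓝 p, x ∈ M →
    N x 2 ^ 2 = 1 - (x 0 ^ 2 + x 1 ^ 2) * parallelCurvature a b (x 0 ^ 2 + x 1 ^ 2) ^ 2 := by
  filter_upwards [h.norm_eq_one, h.apply_zero, h.apply_one] with x hx h0 h1 hM
  have := norm_sq_E3 (N x)
  rw [hx hM, h0 hM, h1 hM] at this
  rcases h.sign with rfl | rfl <;> linear_combination -this

theorem two_sq_self :
    N p 2 ^ 2 = 1 - (p 0 ^ 2 + p 1 ^ 2) * parallelCurvature a b (p 0 ^ 2 + p 1 ^ 2) ^ 2 :=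
  h.apply_two_sq.self_of_nhds h.mem

omit h in
theorem _root_.hasDerivAt_parallelCurvature_comp {γ : ℝ → E3} {t : ℝ} (hγ : HasDerivAt γ τ t) :
    HasDerivAt (fun s => parallelCurvature a b (γ s 0 ^ 2 + γ s 1 ^ 2))
      (a / 2 * (γ t 0 * τ 0 + γ t 1 * τ 1)) t := by
  have := ((((((hγ.apply_E3 0).pow 2).add ((hγ.apply_E3 1).pow 2)).const_mul a).div_const
    4).add_const (b / 2))
  exact this.congr_deriv (by push_cast; ring)

theorem fderiv_zero (hτ : inner ℝ (N p) τ = 0) :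
    fderiv ℝ N p τ 0 = -ε * (parallelCurvature a b (p 0 ^ 2 + p 1 ^ 2) * τ 0 +
      a / 2 * (p 0 * τ 0 + p 1 * τ 1) * p 0) := by
  obtain ⟨γ, rfl, hγ, hM⟩ := h.tangent τ hτ
  have h1 := (h.differentiableAt.hasFDerivAt.comp_hasDerivAt 0 hγ).apply_E3 0
  have h2 := ((hasDerivAt_parallelCurvature_comp (a := a) (b := b) hγ).mul
    (hγ.apply_E3 0)).const_mul (-ε)
  refine (h1.unique (h2.congr_of_eventuallyEq ?_)).trans (by ring)
  filter_upwards [hγ.continuousAt.eventually h.apply_zero, hM] with t ht htM using ht htM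

theorem fderiv_one (hτ : inner ℝ (N p) τ = 0) :
    fderiv ℝ N p τ 1 = -ε * (parallelCurvature a b (p 0 ^ 2 + p 1 ^ 2) * τ 1 +
      a / 2 * (p 0 * τ 0 + p 1 * τ 1) * p 1) := by
  obtain ⟨γ, rfl, hγ, hM⟩ := h.tangent τ hτ
  have h1 := (h.differentiableAt.hasFDerivAt.comp_hasDerivAt 0 hγ).apply_E3 1
  have h2 := ((hasDerivAt_parallelCurvature_comp (a := a) (b := b) hγ).mul
    (hγ.apply_E3 1)).const_mul (-ε)
  refine (h1.unique (h2.congr_of_eventuallyEq ?_)).trans (by ring)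
  filter_upwards [hγ.continuousAt.eventually h.apply_one, hM] with t ht htM using ht htM

/-- Differentiating N₃² = 1 - r² κ² instead of N₃ avoids choosing a square root; the price is the
factor N₃, which is nonzero here and is cancelled later. -/
theorem mul_fderiv_two (hτ : inner ℝ (N p) τ = 0) :
    N p 2 * fderiv ℝ N p τ 2 = -(parallelCurvature a b (p 0 ^ 2 + p 1 ^ 2) ^ 2 +
      (p 0 ^ 2 + p 1 ^ 2) * parallelCurvature a b (p 0 ^ 2 + p 1 ^ 2) * (a / 2)) *
      (p 0 * τ 0 + p 1 * τ 1) := by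
  obtain ⟨γ, rfl, hγ, hM⟩ := h.tangent τ hτ
  have h1 := ((h.differentiableAt.hasFDerivAt.comp_hasDerivAt 0 hγ).apply_E3 2).pow 2
  have h2 := (((((hγ.apply_E3 0).pow 2).add ((hγ.apply_E3 1).pow 2)).mul
    ((hasDerivAt_parallelCurvature_comp (a := a) (b := b) hγ).pow 2)).const_sub 1)
  have h3 := h1.unique (h2.congr_of_eventuallyEq ?_)
  · simp only [Function.comp, Pi.add_apply, Pi.pow_apply] at h3
    norm_num at h3
    linear_combination h3 / 2
  · filter_upwards [hγ.continuousAt.eventually h.apply_two_sq, hM] with t ht htM using ht htM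

/-- The principal curvatures are ε κ along parallels and ε (r κ)' = ε (κ + a r² / 2) along
meridians; their sum is ε (a r² + b). -/
theorem two_mul_meanCurvature :
    2 * meanCurvature N p = ε * (a * (p 0 ^ 2 + p 1 ^ 2) + b) := by
  have hτ := inner_tangentPart h.norm_self
  have h2 := h.mul_fderiv_two (hτ (EuclideanSpace.single 2 1))
  have hN := h.two_sq_self
  rw [meanCurvature, surfaceDiv_eq, Fin.sum_univ_three, h.fderiv_zero (hτ _),
    h.fderiv_one (hτ _)]
  simp only [tangentPart_single_apply, Fin.reduceEq, if_true, if_false] at h2 ⊢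
  have h0' := h.zero_self
  have h1' := h.one_self
  have hs := h.sign
  have hNz := h.vertical_ne_zero
  set q := parallelCurvature a b (p 0 ^ 2 + p 1 ^ 2) with hq
  have h2' : fderiv ℝ N p (tangentPart (N p) (EuclideanSpace.single 2 1)) 2 =
      (q ^ 2 + (p 0 ^ 2 + p 1 ^ 2) * q * (a / 2)) * (p 0 * N p 0 + p 1 * N p 1) := by
    apply mul_left_cancel₀ hNz
    rw [h2]; ring
  rw [h2', h0', h1']
  have hq2 : q = a * (p 0 ^ 2 + p 1 ^ 2) / 4 + b / 2 := hq
  -- Eliminating `b` in favour of `q` leaves a polynomial identity in `a`, `q` and the coordinates.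
  have hb : b = 2 * q - a * (p 0 ^ 2 + p 1 ^ 2) / 2 := by rw [hq2]; ring
  rw [hb]
  clear_value q
  rcases hs with rfl | rfl <;> ring

end IsRotationalNormal

end Curvature

/-! ### The stability operator on a horizontal component of the Gauss map -/

section JacobiOperator

variable {M : Set E3} {N : E3 → E3} {p τ : E3} {a b ε : ℝ}

namespace IsRotationalNormal

/-- The right side is the sum of the squares of the principal curvatures along parallels and
meridians. -/
theorem sqNormSecondForm_eq (h : IsRotationalNormal a b ε M N p) :
    sqNormSecondForm N p = parallelCurvature a b (p 0 ^ 2 + p 1 ^ 2) ^ 2 +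
      (parallelCurvature a b (p 0 ^ 2 + p 1 ^ 2) + a / 2 * (p 0 ^ 2 + p 1 ^ 2)) ^ 2 := by
  have hτ := inner_tangentPart h.norm_self
  have h20 := h.mul_fderiv_two (hτ (EuclideanSpace.single 0 1))
  have h21 := h.mul_fderiv_two (hτ (EuclideanSpace.single 1 1))
  have h22 := h.mul_fderiv_two (hτ (EuclideanSpace.single 2 1))
  have hN := h.two_sq_self
  simp only [sqNormSecondForm, Fin.sum_univ_three, norm_sq_E3, h.fderiv_zero (hτ _),
    h.fderiv_one (hτ _)]
  simp only [tangentPart_single_apply, Fin.reduceEq, if_true, if_false] at h20 h21 h22 ⊢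
  have h0 := h.zero_self
  have h1 := h.one_self
  have hs := h.sign
  have hNz := h.vertical_ne_zero
  set q := parallelCurvature a b (p 0 ^ 2 + p 1 ^ 2) with hq
  clear_value q
  set D0 := fderiv ℝ N p (tangentPart (N p) (EuclideanSpace.single 0 1)) 2
  set D1 := fderiv ℝ N p (tangentPart (N p) (EuclideanSpace.single 1 1)) 2
  set D2 := fderiv ℝ N p (tangentPart (N p) (EuclideanSpace.single 2 1)) 2
  -- Only N₃ times each vertical derivative is known, so the vertical contribution is computed after
  -- multiplication by N₃².
  have hD : D0 ^ 2 + D1 ^ 2 + D2 ^ 2 =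
      (q ^ 2 + (p 0 ^ 2 + p 1 ^ 2) * q * (a / 2)) ^ 2 * (p 0 ^ 2 + p 1 ^ 2) := by
    apply mul_left_cancel₀ (pow_ne_zero 2 hNz)
    have e : N p 2 ^ 2 * (D0 ^ 2 + D1 ^ 2 + D2 ^ 2) =
      (N p 2 * D0) ^ 2 + (N p 2 * D1) ^ 2 + (N p 2 * D2) ^ 2 := by ring
    rw [e, h20, h21, h22, h0, h1]
    have e2 : ∀ A B C K : ℝ, (-K * A) ^ 2 + (-K * B) ^ 2 + (-K * C) ^ 2 =
      K ^ 2 * (A ^ 2 + B ^ 2 + C ^ 2) := by intros; ring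
    rw [e2]
    rcases hs with rfl | rfl <;>
    linear_combination (q ^ 2 + (p 0 ^ 2 + p 1 ^ 2) * q * (a / 2)) ^ 2 *
      ((p 0 ^ 2 + p 1 ^ 2) ^ 2 * q ^ 2 - (p 0 ^ 2 + p 1 ^ 2)) * hN
  have e : ∀ A0 A1 A2 B0 B1 B2 : ℝ, A0 ^ 2 + B0 ^ 2 + D0 ^ 2 + (A1 ^ 2 + B1 ^ 2 + D1 ^ 2) +
      (A2 ^ 2 + B2 ^ 2 + D2 ^ 2) = A0 ^ 2 + B0 ^ 2 + (A1 ^ 2 + B1 ^ 2) + (A2 ^ 2 + B2 ^ 2) +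
      (D0 ^ 2 + D1 ^ 2 + D2 ^ 2) := by intros; ring
  rw [e, hD]
  rw [h0, h1]
  rcases hs with rfl | rfl <;>
  linear_combination (p 0 ^ 2 + p 1 ^ 2) * q ^ 2 *
    (q ^ 2 + (a * q + a ^ 2 / 4 * (p 0 ^ 2 + p 1 ^ 2)) * (p 0 ^ 2 + p 1 ^ 2)) * hN

end IsRotationalNormal

/-- Minus the gradient in `ℝ³` of the polynomial `x₁ (a r² / 4 + b / 2)`, which restricts to minus
the first component of the Gauss map. -/
noncomputable def normalGradient (a b : ℝ) (x : E3) : E3 :=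
  !₂[-(parallelCurvature a b (x 0 ^ 2 + x 1 ^ 2) + a / 2 * x 0 ^ 2), -(a / 2 * (x 0 * x 1)), 0]

theorem differentiable_normalGradient : Differentiable ℝ (normalGradient a b) := by
  rw [differentiable_euclidean]
  intro i
  unfold normalGradient parallelCurvature
  fin_cases i <;> simp <;> fun_prop

theorem differentiableAt_gradient {f : E3 → ℝ} (hf : ContDiff ℝ 2 f) :
    DifferentiableAt ℝ (gradient f) p := by
  have h1 : Differentiable ℝ (fderiv ℝ f) :=
    (hf.fderiv_right (m := 1) (by norm_num)).differentiable (by norm_num)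
  exact ((InnerProductSpace.toDual ℝ E3).symm.toContinuousLinearEquiv.differentiableAt).comp p
    h1.differentiableAt

theorem DifferentiableAt.tangentPart {n w : E3 → E3} (hn : DifferentiableAt ℝ n p)
    (hw : DifferentiableAt ℝ w p) : DifferentiableAt ℝ (fun x => tangentPart (n x) (w x)) p :=
  hw.sub ((hw.inner ℝ hn).smul hn)

theorem inner_tangentPart_left (n v w : E3) :
    inner ℝ (tangentPart n v) w = inner ℝ v (tangentPart n w) := by
  simp only [_root_.tangentPart, inner_sub_left, inner_sub_right, real_inner_smul_left,
    real_inner_smul_right]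
  rw [real_inner_comm w n]
  ring

/-- The sum is the tangential part of `n` itself. -/
theorem sum_normal_smul_tangentPart {n : E3} (hn : ‖n‖ = 1) :
    ∑ i, n i • tangentPart n (EuclideanSpace.single i 1) = 0 := by
  have h := norm_sq_E3 n
  rw [hn] at h
  ext j
  simp only [Fin.sum_univ_three, PiLp.add_apply, PiLp.smul_apply, tangentPart_single_apply,
    smul_eq_mul, PiLp.zero_apply]
  fin_cases j
  all_goals simp
  · linear_combination (n 0) * h
  · linear_combination (n 1) * h
  · linear_combination (n 2) * h

/-- Product rule for G - ⟨G, N⟩ N: the term where the derivative falls on ⟨G, N⟩ is the derivative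
of that function along the tangential part of N, which vanishes. Since div N = -2H, this reduces Δ
N₁ to div G + 2H ⟨G, N⟩. -/
theorem surfaceDiv_tangentPart {G : E3 → E3} (hn : ‖N p‖ = 1) (hN : DifferentiableAt ℝ N p)
    (hG : DifferentiableAt ℝ G p) :
    surfaceDiv N (fun x => tangentPart (N x) (G x)) p =
      surfaceDiv N G p - inner ℝ (G p) (N p) * surfaceDiv N N p := by
  have hl : DifferentiableAt ℝ (fun x => inner ℝ (G x) (N x)) p := hG.inner ℝ hN
  have hd : ∀ τ, fderiv ℝ (fun x => tangentPart (N x) (G x)) p τ = fderiv ℝ G p τ -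
      (inner ℝ (G p) (N p) • fderiv ℝ N p τ +
        fderiv ℝ (fun x => inner ℝ (G x) (N x)) p τ • N p) := by
    intro τ
    have h1 := (hG.hasFDerivAt.sub (hl.hasFDerivAt.smul hN.hasFDerivAt)).fderiv
    exact congrArg (fun L : E3 →L[ℝ] E3 => L τ) h1
  have h0 : ∑ i, fderiv ℝ (fun x => inner ℝ (G x) (N x)) p
      (tangentPart (N p) (EuclideanSpace.single i 1)) * N p i = 0 := by
    have := congrArg (fderiv ℝ (fun x => inner ℝ (G x) (N x)) p) (sum_normal_smul_tangentPart hn)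
    rw [map_sum, map_zero] at this
    rw [← this]
    refine Finset.sum_congr rfl fun i _ => ?_
    rw [map_smul, smul_eq_mul, mul_comm]
  simp only [surfaceDiv_eq, hd, PiLp.sub_apply, PiLp.add_apply, PiLp.smul_apply, smul_eq_mul,
    Finset.sum_sub_distrib, Finset.sum_add_distrib, h0, Finset.mul_sum]
  ring

theorem fderiv_normalGradient (p τ : E3) :
    fderiv ℝ (normalGradient a b) p τ 0 =
      -(a / 2 * (p 0 * τ 0 + p 1 * τ 1) + a * p 0 * τ 0) ∧
    fderiv ℝ (normalGradient a b) p τ 1 = -(a / 2 * (τ 0 * p 1 + p 0 * τ 1)) ∧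
    fderiv ℝ (normalGradient a b) p τ 2 = 0 := by
  have hγ : HasDerivAt (fun t : ℝ => p + t • τ) τ 0 := by
    simpa using ((hasDerivAt_id (0 : ℝ)).smul_const τ).const_add p
  have hG : HasFDerivAt (normalGradient a b) (fderiv ℝ (normalGradient a b) p)
      (p + (0 : ℝ) • τ) := by
    simpa using (differentiable_normalGradient p).hasFDerivAt
  have hd := hG.comp_hasDerivAt 0 hγ
  have hq := hasDerivAt_parallelCurvature_comp (a := a) (b := b) hγ
  have h0 := hγ.apply_E3 0
  have h1 := hγ.apply_E3 1
  refine ⟨?_, ?_, ?_⟩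
  · refine ((hd.apply_E3 0).unique (hq.add ((h0.pow 2).const_mul (a / 2))).neg).trans ?_
    simp
    ring
  · refine ((hd.apply_E3 1).unique ((h0.mul h1).const_mul (a / 2)).neg).trans ?_
    simp
  · exact (hd.apply_E3 2).unique (hasDerivAt_const (0 : ℝ) (0 : ℝ))

namespace IsRotationalNormal

/-- Pairing with `w` turns both sides into derivatives along the tangential part of `w`, where N₁
and -κ x₁ agree. -/
theorem surfaceGradient_eq (h : IsRotationalNormal a b 1 M N p) :
    surfaceGradient N (fun x => N x 0) p = tangentPart (N p) (normalGradient a b p) := by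
  have hn := h.norm_self
  refine ext_inner_right ℝ fun w => ?_
  rw [surfaceGradient, inner_tangentPart_left, inner_tangentPart_left, inner_gradient_left,
    fderiv_apply_E3 h.differentiableAt, h.fderiv_zero (inner_tangentPart hn w), inner_E3]
  simp [normalGradient]
  ring

/-- The stability operator maps the component `N₁` of the Gauss map to `-2 a x₁`. -/
theorem jacobiOperator_eq (hN : ContDiff ℝ ∞ N)
    (h : ∀ᶠ x in 𝓝 p, x ∈ M → IsRotationalNormal a b 1 M N x) (hp : p ∈ M) :
    jacobiOperator a N (fun x => N x 0) p = -2 * a * p 0 := by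
  have h' := h.self_of_nhds hp
  have hn := h'.norm_self
  have hN0 : ContDiff ℝ 2 fun x => N x 0 :=
    ((EuclideanSpace.proj (𝕜 := ℝ) (0 : Fin 3)).contDiff.comp hN).of_le (by norm_cast)
  have hG := differentiable_normalGradient (a := a) (b := b) p
  -- The two gradient fields coincide only on `M`, which suffices because the divergence uses
  -- tangential derivatives alone.
  have hlap : surfaceLaplacian N (fun x => N x 0) p =
      surfaceDiv N (fun x => tangentPart (N x) (normalGradient a b x)) p := by
    refine IsTangentVector.surfaceDiv_congr h'.tangent hn
      (h'.differentiableAt.tangentPart (differentiableAt_gradient hN0))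
      (h'.differentiableAt.tangentPart hG) ?_
    filter_upwards [h] with x hx hxM using (hx hxM).surfaceGradient_eq
  have hH := h'.two_mul_meanCurvature
  have hdiv : surfaceDiv N N p = -(a * (p 0 ^ 2 + p 1 ^ 2) + b) := by
    rw [meanCurvature] at hH
    linear_combination -hH
  -- N₃ drops out: the gradient field is horizontal, and h - x₃ N₃ keeps only the horizontal part of
  -- ⟨N, x⟩. What remains is polynomial in `a`, `q`, x₁ and x₂.
  rw [jacobiOperator, hlap, surfaceDiv_tangentPart hn h'.differentiableAt hG, hdiv,
    h'.sqNormSecondForm_eq, surfaceDiv_eq, Fin.sum_univ_three, (fderiv_normalGradient _ _).1,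
    (fderiv_normalGradient _ _).2.1, (fderiv_normalGradient _ _).2.2, inner_E3, inner_E3]
  have h0 := h'.zero_self
  have h1 := h'.one_self
  simp only [tangentPart_single_apply, Fin.reduceEq, if_true, if_false, normalGradient,
    Matrix.cons_val_zero, Matrix.cons_val_one, Matrix.cons_val]
  set q := parallelCurvature a b (p 0 ^ 2 + p 1 ^ 2) with hq
  have hq2 : q = a * (p 0 ^ 2 + p 1 ^ 2) / 4 + b / 2 := hq
  have hb : b = 2 * q - a * (p 0 ^ 2 + p 1 ^ 2) / 2 := by rw [hq2]; ring
  rw [hb, h0, h1]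
  clear_value q
  ring

end IsRotationalNormal

end JacobiOperator

/-! ### The Gauss map of a stationary rotating surface of revolution -/

section GaussMap

variable {a b c z : ℝ} {u : ℝ → ℝ} {N : E3 → E3} {p : E3}

/-- Away from the axis and the equator, the positivity of the mean curvature determines the
orientation of the surface. -/
theorem IsStationaryRotatingSurface.isRotationalNormal (ha : 0 < a) (hb : 0 ≤ b)
    (hu : IsProfile a b c u)
    (hN : IsStationaryRotatingSurface a b (closedSurfaceOfRevolution u c z) N)
    (hpM : p ∈ closedSurfaceOfRevolution u c z) (hp : axisDist p ∈ Ioo 0 c) :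
    IsRotationalNormal a b 1 (closedSurfaceOfRevolution u c z) N p := by
  have hM := hN.surface
  have hz : ∀ r ∈ Ico 0 c, u r < z := fun r hr => hu.lt_of_isCompact ha hb hM.isCompact hr
  obtain ⟨ε, hε, hpos, h0, h1⟩ := exists_normal_eq hu hz hM hpM hp
  have hNc : Continuous N := hM.smooth_normal.continuous
  have hnear : ∀ᶠ x in 𝓝 p, axisDist x ∈ Ioo 0 c ∧ 0 < ε * ((z - x 2) * N x 2) := by
    refine (continuous_axisDist.continuousAt.eventually (isOpen_Ioo.mem_nhds hp)).and ?_
    have hc : Continuous fun x : E3 => ε * ((z - x 2) * N x 2) := by fun_prop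
    exact continuousAt_const.eventually_lt hc.continuousAt hpos
  have heq : ∀ᶠ x in 𝓝 p, x ∈ closedSurfaceOfRevolution u c z →
      N x 0 = -ε * (parallelCurvature a b (x 0 ^ 2 + x 1 ^ 2) * x 0) ∧
      N x 1 = -ε * (parallelCurvature a b (x 0 ^ 2 + x 1 ^ 2) * x 1) := by
    filter_upwards [hnear] with x hx hxM
    obtain ⟨ε', hε', hpos', h⟩ := exists_normal_eq hu hz hM hxM hx.1
    -- The sign is locally constant: it is the sign of (z - x₃) N₃, which is continuous and nonzero
    -- at `p`.
    have : ε' = ε := by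
      rcases hε with rfl | rfl <;> rcases hε' with rfl | rfl <;> first | rfl | linarith [hx.2]
    rwa [this] at h
  have hrot : IsRotationalNormal a b ε (closedSurfaceOfRevolution u c z) N p :=
    { differentiableAt := hM.smooth_normal.differentiable (by simp) p
      norm_eq_one := Eventually.of_forall hM.norm_normal
      mem := hpM
      tangent := fun τ hτ => isTangentVector_of_inner_eq_zero hu hM hpM hp hτ
      vertical_ne_zero := fun h => by simp [h] at hpos
      apply_zero := heq.mono fun x hx hxM => (hx hxM).1
      apply_one := heq.mono fun x hx hxM => (hx hxM).2
      sign := hε }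
  rcases hε with rfl | rfl
  · exact hrot
  -- The other orientation would give a r² + b = -(a r² + b), impossible off the axis.
  · have e1 := hrot.two_mul_meanCurvature
    rw [hN.laplace_eq p hpM, sq_axisDist] at e1
    have : 0 < a * (p 0 ^ 2 + p 1 ^ 2) := by
      rw [← sq_axisDist]
      have := hp.1
      positivity
    linarith

theorem IsStationaryRotatingSurface.normal_zero_eq (ha : 0 < a) (hb : 0 ≤ b)
    (hu : IsProfile a b c u)
    (hN : IsStationaryRotatingSurface a b (closedSurfaceOfRevolution u c z) N)
    (hpM : p ∈ closedSurfaceOfRevolution u c z) (hp : axisDist p ∈ Ioo 0 c) :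
    N p 0 = -(parallelCurvature a b (p 0 ^ 2 + p 1 ^ 2) * p 0) := by
  rw [(hN.isRotationalNormal ha hb hu hpM hp).zero_self]
  ring

theorem IsStationaryRotatingSurface.jacobiOperator_eq (ha : 0 < a) (hb : 0 ≤ b)
    (hu : IsProfile a b c u)
    (hN : IsStationaryRotatingSurface a b (closedSurfaceOfRevolution u c z) N)
    (hpM : p ∈ closedSurfaceOfRevolution u c z) (hp : axisDist p ∈ Ioo 0 c) :
    jacobiOperator a N (fun x => N x 0) p = -2 * a * p 0 := by
  refine IsRotationalNormal.jacobiOperator_eq (b := b) hN.surface.smooth_normal ?_ hpM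
  filter_upwards [continuous_axisDist.continuousAt.eventually (isOpen_Ioo.mem_nhds hp)]
    with x hx hxM using hN.isRotationalNormal ha hb hu hxM hx

end GaussMap

/-! ### Integration over a surface of revolution -/

section Integration

open scoped Real

local notation "E2" => EuclideanSpace ℝ (Fin 2)

variable {a b c z : ℝ} {u : ℝ → ℝ}

/-- One half of the surface of revolution in polar coordinates; the lower half is `σ = 1`, the
upper half `σ = -1`. -/
noncomputable def revolutionChart (u : ℝ → ℝ) (z σ : ℝ) (y : E2) : E3 :=
  !₂[y 0 * Real.cos (y 1), y 0 * Real.sin (y 1), z + σ * (u (y 0) - z)]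

/-- The domain of the polar coordinates. -/
def polarRectangle (c : ℝ) : Set E2 := {y | y 0 ∈ Ioo 0 c ∧ y 1 ∈ Ioo (-π) π}

theorem isOpen_polarRectangle (c : ℝ) : IsOpen (polarRectangle c) :=
  (isOpen_Ioo.preimage (by fun_prop : Continuous fun y : E2 => y 0)).inter
    (isOpen_Ioo.preimage (by fun_prop : Continuous fun y : E2 => y 1))

/-- The derivative of `revolutionChart`. -/
noncomputable def revolutionChartDeriv (u : ℝ → ℝ) (σ : ℝ) (y : E2) : E2 →L[ℝ] E3 :=
  ((PiLp.continuousLinearEquiv 2 ℝ (fun _ : Fin 3 => ℝ)).symm : (Fin 3 → ℝ) →L[ℝ] E3) ∘L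
    ContinuousLinearMap.pi ![
      Real.cos (y 1) • EuclideanSpace.proj 0 - (y 0 * Real.sin (y 1)) • EuclideanSpace.proj 1,
      Real.sin (y 1) • EuclideanSpace.proj 0 + (y 0 * Real.cos (y 1)) • EuclideanSpace.proj 1,
      (σ * deriv u (y 0)) • EuclideanSpace.proj 0]

/-- A square matrix with the same metric distortion as `revolutionChartDeriv`. -/
noncomputable def revolutionChartMetric (u : ℝ → ℝ) (y : E2) : E2 →L[ℝ] E2 :=
  ((PiLp.continuousLinearEquiv 2 ℝ (fun _ : Fin 2 => ℝ)).symm : (Fin 2 → ℝ) →L[ℝ] E2) ∘L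
    ContinuousLinearMap.pi ![√(1 + deriv u (y 0) ^ 2) • EuclideanSpace.proj 0,
      y 0 • EuclideanSpace.proj 1]

theorem hasStrictFDerivAt_revolutionChart (hu : IsProfile a b c u) (σ : ℝ) {y : E2}
    (hy : y ∈ polarRectangle c) :
    HasStrictFDerivAt (revolutionChart u z σ) (revolutionChartDeriv u σ y) y := by
  have h0 : HasStrictFDerivAt (fun y : E2 => y 0) (EuclideanSpace.proj 0 : E2 →L[ℝ] ℝ) y :=
    (EuclideanSpace.proj (𝕜 := ℝ) (0 : Fin 2)).hasStrictFDerivAt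
  have h1 : HasStrictFDerivAt (fun y : E2 => y 1) (EuclideanSpace.proj 1 : E2 →L[ℝ] ℝ) y :=
    (EuclideanSpace.proj (𝕜 := ℝ) (1 : Fin 2)).hasStrictFDerivAt
  rw [hasStrictFDerivAt_euclidean]
  intro i
  fin_cases i
  · refine (h0.mul h1.cos).congr_fderiv ?_
    ext v
    simp [revolutionChartDeriv]
    ring
  · refine (h0.mul h1.sin).congr_fderiv ?_
    ext v
    simp [revolutionChartDeriv]
    ring
  · have h2 := ((((hu.hasStrictDerivAt hy.1).comp_hasStrictFDerivAt y h0).sub_const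
      z).const_mul σ).const_add z
    refine h2.congr_fderiv ?_
    ext v
    simp [revolutionChartDeriv]
    ring

/-- The first fundamental form of either sheet is diag(1 + u'², r²); the square matrix is its square
root. -/
theorem norm_revolutionChartDeriv {σ : ℝ} (hσ : σ ^ 2 = 1) (y v : E2) :
    ‖revolutionChartDeriv u σ y v‖ = ‖revolutionChartMetric u y v‖ := by
  rw [← sq_eq_sq₀ (norm_nonneg _) (norm_nonneg _), norm_sq_E3, EuclideanSpace.norm_sq_eq,
    Fin.sum_univ_two]
  simp [revolutionChartDeriv, revolutionChartMetric]
  have hw : √(1 + deriv u (y 0) ^ 2) ^ 2 = 1 + deriv u (y 0) ^ 2 := Real.sq_sqrt (by positivity)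
  simp only [mul_pow, sq_abs, hw, hσ]
  linear_combination (v 0 ^ 2 + y 0 ^ 2 * v 1 ^ 2) * Real.sin_sq_add_cos_sq (y 1)

theorem det_revolutionChartMetric (y : E2) :
    (revolutionChartMetric u y).det = y 0 * √(1 + deriv u (y 0) ^ 2) := by
  rw [ContinuousLinearMap.det, ← LinearMap.det_toMatrix (EuclideanSpace.basisFun (Fin 2) ℝ).toBasis,
    Matrix.det_fin_two]
  simp [LinearMap.toMatrix_apply, revolutionChartMetric]
  ring

theorem axisDist_revolutionChart {σ : ℝ} {y : E2} (hy : 0 ≤ y 0) :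
    axisDist (revolutionChart u z σ y) = y 0 := by
  have : (y 0 * Real.cos (y 1)) ^ 2 + (y 0 * Real.sin (y 1)) ^ 2 = y 0 ^ 2 := by
    linear_combination y 0 ^ 2 * Real.sin_sq_add_cos_sq (y 1)
  simp [axisDist, revolutionChart, this, Real.sqrt_sq hy]

theorem injOn_revolutionChart (σ : ℝ) : InjOn (revolutionChart u z σ) (polarRectangle c) := by
  intro y hy y' hy' h
  have h0 := congrArg (fun x : E3 => x 0) h
  have h1 := congrArg (fun x : E3 => x 1) h
  simp [revolutionChart] at h0 h1
  have := polarCoord.symm.injOn (x₁ := (y 0, y 1)) (x₂ := (y' 0, y' 1)) ⟨hy.1.1, hy.2⟩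
    ⟨hy'.1.1, hy'.2⟩ (by simp [polarCoord, h0, h1])
  ext i
  fin_cases i
  · exact congrArg Prod.fst this
  · exact congrArg Prod.snd this

theorem image_revolutionChart_subset {σ : ℝ} (hσ : σ = 1 ∨ σ = -1) :
    revolutionChart u z σ '' polarRectangle c ⊆
      closedSurfaceOfRevolution u c z ∩ {x | axisDist x ∈ Ioo 0 c} := by
  rintro _ ⟨y, hy, rfl⟩
  have h := axisDist_revolutionChart (u := u) (z := z) (σ := σ) hy.1.1.le
  refine ⟨mem_of_sheet (by rw [h]; exact hy.1.2) hσ (by rw [h]; simp [revolutionChart]), ?_⟩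
  rw [mem_ofPred_eq, h]
  exact hy.1

theorem measurableSet_image_revolutionChart (hu : IsProfile a b c u) (σ : ℝ) :
    MeasurableSet (revolutionChart u z σ '' polarRectangle c) :=
  (isOpen_polarRectangle c).measurableSet.image_of_continuousOn_injOn
    (fun _ hy => (hasStrictFDerivAt_revolutionChart hu σ hy).continuousAt.continuousWithinAt)
    (injOn_revolutionChart σ)

theorem euclideanHausdorffMeasure_two_eq_zero {S : Set E3} (h : dimH S ≤ 1) : μHE[2] S = 0 := by
  have h2 : Measure.hausdorffMeasure ((2 : NNReal) : ℝ) S = 0 :=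
    hausdorffMeasure_of_dimH_lt (h.trans_lt (by norm_num))
  rw [Measure.euclideanHausdorffMeasure_def, Measure.smul_apply]
  simpa using Or.inr h2

/-- The charts miss only the equator and one meridian of each sheet, poles included. These are C¹
images of one-dimensional sets, so they have no area. -/
theorem closedSurfaceOfRevolution_ae_eq (hu : IsProfile a b c u) :
    closedSurfaceOfRevolution u c z =ᵐ[μHE[2]]
      (revolutionChart u z 1 '' polarRectangle c ∪
        revolutionChart u z (-1) '' polarRectangle c : Set E3) := by
  set circle : Set E3 := range fun t : ℝ => !₂[c * Real.cos t, c * Real.sin t, z]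
  -- The minus sign puts the curve in the half-plane θ = π, the slit of the polar coordinates.
  set meridian : ℝ → Set E3 := fun σ => (fun r : ℝ => !₂[-r, 0, z + σ * (u r - z)]) '' Ico 0 c
  have hcircle : μHE[2] circle = 0 := by
    refine euclideanHausdorffMeasure_two_eq_zero ?_
    have : ContDiff ℝ 1 fun t : ℝ => (!₂[c * Real.cos t, c * Real.sin t, z] : E3) := by
      rw [contDiff_euclidean]
      intro i
      fin_cases i <;> simp <;> fun_prop
    simpa using this.dimH_range_le
  have hmeridian : ∀ σ, μHE[2] (meridian σ) = 0 := by
    intro σ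
    refine euclideanHausdorffMeasure_two_eq_zero ?_
    have hu1 : ContDiffOn ℝ 1 u (Ico 0 c) := hu.contDiffOn.of_le (by norm_num)
    have : ContDiffOn ℝ 1 (fun r : ℝ => (!₂[-r, 0, z + σ * (u r - z)] : E3)) (Ico 0 c) := by
      rw [contDiffOn_euclidean]
      intro i
      fin_cases i <;> simp <;> fun_prop
    refine (this.dimH_image_le (convex_Ico 0 c) subset_rfl).trans ?_
    exact (dimH_mono (subset_univ _)).trans Real.dimH_univ.le
  refine (ae_eq_set.2 ⟨?_, ?_⟩)
  · refine measure_mono_null (t := circle ∪ (meridian 1 ∪ meridian (-1))) ?_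
      (measure_union_null hcircle (measure_union_null (hmeridian 1) (hmeridian (-1))))
    rintro x ⟨hx, hx'⟩
    by_cases hc : axisDist x < c
    · obtain ⟨σ, hσ, h⟩ := exists_sheet hx hc
      have hnot : x ∉ revolutionChart u z σ '' polarRectangle c := by
        rcases hσ with rfl | rfl
        · exact fun h => hx' (Or.inl h)
        · exact fun h => hx' (Or.inr h)
      by_cases hs : (x 0, x 1) ∈ polarCoord.source
      · exfalso
        have ht := polarCoord.map_source hs
        have hl := polarCoord.left_inv hs
        set q := polarCoord (x 0, x 1)
        have ht' : q.1 ∈ Ioi 0 ∧ q.2 ∈ Ioo (-π) π := ht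
        rw [polarCoord_symm_apply, Prod.mk.injEq] at hl
        have hax : axisDist x = q.1 := by
          rw [axisDist, ← hl.1, ← hl.2, ← Real.sqrt_sq ht'.1.le]
          congr 1
          rw [Real.sqrt_sq ht'.1.le]
          linear_combination q.1 ^ 2 * Real.sin_sq_add_cos_sq q.2
        refine hnot ⟨!₂[q.1, q.2], ⟨⟨ht'.1, by simpa [← hax] using hc⟩, ht'.2⟩, ?_⟩
        ext i
        fin_cases i
        · simpa [revolutionChart] using hl.1
        · simpa [revolutionChart] using hl.2
        · simp [revolutionChart, h, hax]
      · simp [polarCoord] at hs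
        have hax : axisDist x = - x 0 := by
          rw [axisDist, hs.2]
          simp [Real.sqrt_sq_eq_abs, abs_of_nonpos hs.1]
        have hxm : x ∈ meridian σ := by
          refine ⟨axisDist x, ⟨axisDist_nonneg x, hc⟩, ?_⟩
          ext i
          fin_cases i
          · simp [hax]
          · simp [hs.2]
          · simp [h]
        right
        rcases hσ with rfl | rfl
        · exact Or.inl hxm
        · exact Or.inr hxm
    · left
      have hx2 : axisDist x = c ∧ x 2 = z := by
        rcases hx with h | h
        · exact absurd h.1 hc
        · exact h
      have hn : ‖(⟨x 0, x 1⟩ : ℂ)‖ = c := by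
        rw [← hx2.1, axisDist, Complex.norm_def, Complex.normSq_mk]
        congr 1; ring
      refine ⟨Complex.arg ⟨x 0, x 1⟩, ?_⟩
      have h0 := Complex.norm_mul_cos_arg ⟨x 0, x 1⟩
      have h1 := Complex.norm_mul_sin_arg ⟨x 0, x 1⟩
      rw [hn] at h0 h1
      ext i
      fin_cases i
      · simpa using h0
      · simpa using h1
      · simp [hx2.2]
  · rw [sdiff_eq_empty.2, measure_empty]
    exact union_subset ((image_revolutionChart_subset (Or.inl rfl)).trans inter_subset_left)
      ((image_revolutionChart_subset (Or.inr rfl)).trans inter_subset_left)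

theorem measurePreserving_E2_prod :
    MeasurePreserving (fun y : E2 => (y 0, y 1)) volume (volume.prod volume) :=
  (volume_preserving_finTwoArrow ℝ).comp
    (EuclideanSpace.volume_preserving_symm_measurableEquiv_toLp (Fin 2))

theorem measurableEmbedding_E2_prod : MeasurableEmbedding (fun y : E2 => (y 0, y 1)) :=
  ((MeasurableEquiv.toLp 2 (Fin 2 → ℝ)).symm.trans MeasurableEquiv.finTwoArrow).measurableEmbedding

theorem setIntegral_polarRectangle (g k : ℝ → ℝ) :
    ∫ y in polarRectangle c, g (y 0) * k (y 1) =
      (∫ r in Ioo 0 c, g r) * ∫ θ in Ioo (-π) π, k θ := by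
  rw [← setIntegral_prod_mul]
  exact measurePreserving_E2_prod.setIntegral_preimage_emb measurableEmbedding_E2_prod
    (fun w => g w.1 * k w.2) (Ioo 0 c ×ˢ Ioo (-π) π)

theorem integrableOn_polarRectangle {g k : ℝ → ℝ} (hg : IntegrableOn g (Ioo 0 c))
    (hk : IntegrableOn k (Ioo (-π) π)) :
    IntegrableOn (fun y : E2 => g (y 0) * k (y 1)) (polarRectangle c) := by
  have h := hg.mul_prod hk
  rw [Measure.prod_restrict] at h
  exact (measurePreserving_E2_prod.integrableOn_comp_preimage measurableEmbedding_E2_prod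
    (f := fun w : ℝ × ℝ => g w.1 * k w.2) (s := Ioo 0 c ×ˢ Ioo (-π) π)).2 h

/-- Integration over a surface of revolution in polar coordinates. -/
theorem surfaceIntegral_closedSurfaceOfRevolution (hu : IsProfile a b c u)
    (hz : ∀ r ∈ Ico 0 c, u r < z) {f : E3 → ℝ} {g k : ℝ → ℝ}
    (hf : ∀ r ∈ Ioo 0 c, ∀ θ ζ : ℝ, r * √(1 + deriv u r ^ 2) *
      f !₂[r * Real.cos θ, r * Real.sin θ, ζ] = g r * k θ)
    (hg : IntegrableOn g (Ioo 0 c)) (hk : IntegrableOn k (Ioo (-π) π)) :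
    surfaceIntegral (closedSurfaceOfRevolution u c z) f =
      2 * ((∫ r in Ioo 0 c, g r) * ∫ θ in Ioo (-π) π, k θ) := by
  -- The integrand does not depend on the height ζ, so both sheets give the same integral; hence the
  -- factor 2.
  have hsheet : ∀ σ : ℝ, σ ^ 2 = 1 →
      ∫ x in revolutionChart u z σ '' polarRectangle c, f x ∂μHE[2] =
        (∫ r in Ioo 0 c, g r) * ∫ θ in Ioo (-π) π, k θ ∧
      IntegrableOn f (revolutionChart u z σ '' polarRectangle c) μHE[2] := by
    intro σ hσ
    have hpos : ∀ y ∈ polarRectangle c, 0 < (revolutionChartMetric u y).det := by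
      intro y hy
      rw [det_revolutionChartMetric]
      exact mul_pos hy.1.1 (Real.sqrt_pos.2 (by positivity))
    have hcont : ContinuousOn (fun y => (revolutionChartMetric u y).det) (polarRectangle c) := by
      simp only [det_revolutionChartMetric]
      have hd : ContinuousOn (fun y : E2 => deriv u (y 0)) (polarRectangle c) :=
        hu.continuousOn_deriv.comp (by fun_prop) fun y hy => hy.1
      fun_prop
    have harea := integral_image_euclideanHausdorffMeasure (isOpen_polarRectangle c)
      (fun y hy => hasStrictFDerivAt_revolutionChart (z := z) hu σ hy)
      (fun y _ v => norm_revolutionChartDeriv hσ y v) (fun y hy => (hpos y hy).ne') hcont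
      (injOn_revolutionChart σ) f
    have hcongr : EqOn (fun y => |(revolutionChartMetric u y).det| * f (revolutionChart u z σ y))
        (fun y => g (y 0) * k (y 1)) (polarRectangle c) := by
      intro y hy
      simp only
      rw [abs_of_pos (hpos y hy), det_revolutionChartMetric]
      exact hf _ hy.1 _ _
    have hmeas := (isOpen_polarRectangle c).measurableSet
    rw [setIntegral_congr_fun hmeas hcongr, integrableOn_congr_fun hcongr hmeas,
      setIntegral_polarRectangle] at harea
    exact ⟨harea.1, harea.2.2 (integrableOn_polarRectangle hg hk)⟩
  -- The open sheets lie strictly on opposite sides of the plane x₃ = z because u < z.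
  have hdisj : Disjoint (revolutionChart u z 1 '' polarRectangle c)
      (revolutionChart u z (-1) '' polarRectangle c) := by
    rw [Set.disjoint_left]
    rintro _ ⟨y, hy, rfl⟩ ⟨y', hy', h⟩
    have h2 := congrArg (fun x : E3 => x 2) h
    simp [revolutionChart] at h2
    linarith [hz _ (Ioo_subset_Ico_self hy.1), hz _ (Ioo_subset_Ico_self hy'.1)]
  obtain ⟨h1, h1'⟩ := hsheet 1 (by norm_num)
  obtain ⟨h2, h2'⟩ := hsheet (-1) (by norm_num)
  rw [surfaceIntegral, setIntegral_congr_set (closedSurfaceOfRevolution_ae_eq hu),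
    setIntegral_union hdisj (measurableSet_image_revolutionChart hu _) h1' h2', h1, h2]
  ring

end Integration

/-! ### The second variation at a horizontal component of the Gauss map -/

section SecondVariation

open scoped Real

variable {a b c z : ℝ} {u : ℝ → ℝ} {N : E3 → E3}

/-- Poles and equator are null, so the formulas for N₁ and L[N₁] are needed only where the profile
is regular. -/
theorem surfaceIntegral_congr_off_axis_equator (hu : IsProfile a b c u) {f g : E3 → ℝ}
    (h : ∀ x ∈ closedSurfaceOfRevolution u c z, axisDist x ∈ Ioo 0 c → f x = g x) :
    surfaceIntegral (closedSurfaceOfRevolution u c z) f =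
      surfaceIntegral (closedSurfaceOfRevolution u c z) g := by
  have hsub := union_subset (image_revolutionChart_subset (u := u) (c := c) (z := z) (Or.inl rfl))
    (image_revolutionChart_subset (Or.inr rfl))
  rw [surfaceIntegral, surfaceIntegral, setIntegral_congr_set (closedSurfaceOfRevolution_ae_eq hu),
    setIntegral_congr_set (closedSurfaceOfRevolution_ae_eq hu)]
  exact setIntegral_congr_fun ((measurableSet_image_revolutionChart hu _).union
    (measurableSet_image_revolutionChart hu _)) fun x hx => h x (hsub hx).1 (hsub hx).2

/-- This is the first integral read on the area element: κ dM = u' dr dθ. It is the source of u' in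
the formula for Q(N₁). -/
theorem IsProfile.mul_sqrt_mul_parallelCurvature (hu : IsProfile a b c u) {r : ℝ}
    (hr : r ∈ Ioo 0 c) (θ : ℝ) :
    r * √(1 + deriv u r ^ 2) * parallelCurvature a b ((r * Real.cos θ) ^ 2 + (r * Real.sin θ) ^ 2) =
      deriv u r := by
  have h := hu.deriv_div_sqrt hr
  have hw : 0 < √(1 + deriv u r ^ 2) := Real.sqrt_pos.2 (by positivity)
  rw [div_eq_iff hw.ne'] at h
  have e : (r * Real.cos θ) ^ 2 + (r * Real.sin θ) ^ 2 = r ^ 2 := by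
    linear_combination r ^ 2 * Real.sin_sq_add_cos_sq θ
  rw [e]
  linear_combination -h

/-- N₁ dM = -r u' cos θ dr dθ, and cos has mean zero over a period. -/
theorem surfaceIntegral_normal_zero (ha : 0 < a) (hb : 0 ≤ b) (hu : IsProfile a b c u)
    (hz : ∀ r ∈ Ico 0 c, u r < z)
    (hN : IsStationaryRotatingSurface a b (closedSurfaceOfRevolution u c z) N) :
    surfaceIntegral (closedSurfaceOfRevolution u c z) (fun x => N x 0) = 0 := by
  rw [surfaceIntegral_congr_off_axis_equator hu fun x hx hr => hN.normal_zero_eq ha hb hu hx hr,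
    surfaceIntegral_closedSurfaceOfRevolution hu hz (g := fun r => r * deriv u r)
      (k := fun θ => -Real.cos θ)]
  · rw [← integral_Ioc_eq_integral_Ioo (x := -π),
      ← intervalIntegral.integral_of_le (by linarith [Real.pi_pos])]
    simp
  · intro r hr θ ζ
    have := hu.mul_sqrt_mul_parallelCurvature hr θ
    simp
    linear_combination (r * Real.cos θ) * this
  · simpa using hu.integrableOn_pow_mul_deriv ha hb hz 1
  · exact (Real.continuous_cos.neg.integrableOn_Icc).mono_set Ioo_subset_Icc_self

/-- N₁ L[N₁] dM = 2a r² u' cos² θ dr dθ; the factor 4π a is two sheets times 2a times ∫ cos² θ = π.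
-/
theorem secondVariation_normal_zero (ha : 0 < a) (hb : 0 ≤ b) (hu : IsProfile a b c u)
    (hz : ∀ r ∈ Ico 0 c, u r < z)
    (hN : IsStationaryRotatingSurface a b (closedSurfaceOfRevolution u c z) N) :
    secondVariation a (closedSurfaceOfRevolution u c z) N (fun x => N x 0) =
      -4 * π * a * ∫ r in Ioo 0 c, r ^ 2 * deriv u r := by
  rw [secondVariation, surfaceIntegral_congr_off_axis_equator hu (g := fun x =>
      2 * a * (parallelCurvature a b (x 0 ^ 2 + x 1 ^ 2) * x 0 ^ 2)) fun x hx hr => by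
        rw [hN.normal_zero_eq ha hb hu hx hr, hN.jacobiOperator_eq ha hb hu hx hr]; ring,
    surfaceIntegral_closedSurfaceOfRevolution hu hz (g := fun r => r ^ 2 * deriv u r)
      (k := fun θ => 2 * a * Real.cos θ ^ 2)]
  · rw [← integral_Ioc_eq_integral_Ioo (x := -π),
      ← intervalIntegral.integral_of_le (by linarith [Real.pi_pos]),
      intervalIntegral.integral_const_mul, integral_cos_sq]
    simp
    ring
  · intro r hr θ ζ
    have := hu.mul_sqrt_mul_parallelCurvature hr θ
    simp
    linear_combination (2 * a * r ^ 2 * Real.cos θ ^ 2) * this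
  · exact hu.integrableOn_pow_mul_deriv ha hb hz 2
  · exact ((by fun_prop : Continuous fun θ : ℝ => 2 * a * Real.cos θ ^ 2).integrableOn_Icc).mono_set
      Ioo_subset_Icc_self

theorem setIntegral_sq_mul_deriv_pos (ha : 0 < a) (hb : 0 ≤ b) (hu : IsProfile a b c u)
    (hz : ∀ r ∈ Ico 0 c, u r < z) : 0 < ∫ r in Ioo 0 c, r ^ 2 * deriv u r := by
  have hpos : ∀ r ∈ Ioo 0 c, 0 < r ^ 2 * deriv u r := fun r hr =>
    mul_pos (pow_pos hr.1 2) (hu.deriv_pos ha hb hr)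
  rw [setIntegral_pos_iff_support_of_nonneg_ae]
  · have : Function.support (fun r => r ^ 2 * deriv u r) ∩ Ioo 0 c = Ioo 0 c :=
      inter_eq_right.2 fun r hr => (hpos r hr).ne'
    rw [this]
    simp [hu.pos]
  · filter_upwards [ae_restrict_mem measurableSet_Ioo] with r hr using (hpos r hr).le
  · exact hu.integrableOn_pow_mul_deriv ha hb hz 2

end SecondVariation

theorem mainTheorem9 (a b c z : ℝ) (u : ℝ → ℝ) (M : Set E3) (N : E3 → E3)
    (ha : 0 < a) (hb : 0 ≤ b)
    (hu : IsMaximalProfile a b c u)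
    (hM : M = closedSurfaceOfRevolution u c z)
    (hN : IsStationaryRotatingSurface a b M N) :
    ¬ IsStable a M N ∧
    surfaceIntegral M (fun x => N x 0) = 0 ∧
    IntegrableOn (fun r => r ^ 2 * deriv u r) (Ioo 0 c) ∧
    secondVariation a M N (fun x => N x 0)
      = -4 * Real.pi * a * ∫ r in Ioo 0 c, r ^ 2 * deriv u r ∧
    secondVariation a M N (fun x => N x 0) < 0 := by
  subst hM
  replace hu := hu.1
  have hz : ∀ r ∈ Ico 0 c, u r < z := fun r hr => hu.lt_of_isCompact ha hb hN.surface.isCompact hr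
  have hint := hu.integrableOn_pow_mul_deriv ha hb hz 2
  have hmean := surfaceIntegral_normal_zero ha hb hu hz hN
  have hQ := secondVariation_normal_zero ha hb hu hz hN
  have hneg : secondVariation a (closedSurfaceOfRevolution u c z) N (fun x => N x 0) < 0 := by
    have := setIntegral_sq_mul_deriv_pos ha hb hu hz
    rw [hQ]
    have : 0 < 4 * Real.pi * a * ∫ r in Ioo 0 c, r ^ 2 * deriv u r := by positivity
    linarith
  refine ⟨fun hstable => ?_, hmean, hint, hQ, hneg⟩
  have hsmooth : ContDiff ℝ ∞ fun x => N x 0 :=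
    (EuclideanSpace.proj (𝕜 := ℝ) (0 : Fin 3)).contDiff.comp hN.surface.smooth_normal
  exact absurd (hstable _ hsmooth hmean) (not_le.2 hneg)
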